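/- Let $\mathbb T^3=(\mathbb R/2\pi\mathbb Z)^3$ and let $N>0$. For $k=(k_1,k_2,k_3)\in\mathbb Z^3$ with $k_3\neq 0$ put $D(k)=N^4|k|^2k_3^2+k_2^4$ and $$\hat M_1(k)=\frac{N^4k_2k_3|k|^2-N^2k_1k_2^2k_3}{D(k)},\quad \hat M_2(k)=\frac{-N^4k_1k_3|k|^2-N^2k_2^3k_3}{D(k)},\quad \hat M_3(k)=\frac{N^2k_1^2k_2^2+N^2k_2^4}{D(k)},$$ and put $\hat M_j(k)=0$ if $k_3=0$. Let $M=(M_1,M_2,M_3)$ be the Fourier multiplier operator with symbol $\hat M=(\hat M_1,\hat M_2,\hat M_3)$. The non-diffusive magnetogeostrophic (MG) equation for a real scalar $\theta(t,x)$ on $\mathbb T^3$ is $$\partial_t\theta+u\cdot\nabla\theta=0,\qquad u=M[\theta]. \tag{1}$$ A *Sobolev space* is one of the following spaces of real functions on $\mathbb T^3$: $W^{n,p}$ with $n\in\mathbb N_0$, $1\le p\le\infty$; the Bessel potential space $H^{s,p}$ with $s\in\mathbb R$, $1<p<\infty$ (so $H^s=H^{s,2}$); the Sobolev–Slobodeckij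 space $W^{n+\sigma,p}$ with $n\in\mathbb N_0$, $0<\sigma<1$, $1\le p<\infty$. Let $X,Y$ be Sobolev spaces with continuous embeddings $Y\subset X\subset W^{1,4}$. For $T>0$, a solution of (1) in $L^\infty(0,T;X)$ with initial datum $\theta_0$ is a function $\theta\in L^\infty(0,T;X)$, measurable in $(t,x)$, such that for every $k\in\mathbb Z^3$ and a.e. $t\in(0,T)$ $$\hat\theta(t,k)=\hat\theta_0(k)-\int_0^t\big(M[\theta(s)]\cdot\nabla\theta(s)\big)^{\wedge}(k)\,ds .$$ Equation (1) is *locally Lipschitz $(X,Y)$ well-posed* if there exist continuous functions $T,K:[0,\infty)^2\to(0,\infty)$ such that for every pair of initial data $\theta^{(1)}_0,\theta^{(2)}_0\in Y$ with zero vertical mean ($\int\theta^{(i)}_0\,dx_3=0$ for a.e. $(x_1,x_2)$) there exist unique solutions $\theta^{(1)},\theta^{(2)}\in L^\infty(0,T;X)$ of (1) with these initial data, and $$\|\theta^{(1)}(t)-\theta^{(2)}(t)\|_X\le K\,\|\theta^{(1)}_0-\theta^{(2)}_0\|_Y\quad\text{for a.e. }t\in(0,T),$$ where $T$ and $K$ are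 evaluated at $(\|\theta^{(1)}_0\|_Y,\|\theta^{(2)}_0\|_Y)$. **Theorem.** For every $N>0$ and all Sobolev spaces $Y\subset X\subset W^{1,4}$ as above, the non-diffusive MG equation is locally Lipschitz $(X,Y)$ ill-posed, i.e. it is not locally Lipschitz $(X,Y)$ well-posed. -/

import Mathlib

open MeasureTheory Set
open scoped ENNReal NNReal

noncomputable section

namespace MG

/-- The torus `𝕋³ = (ℝ/2πℤ)³`, parametrised by `y ∈ (ℝ/ℤ)³` through `x = 2πy`. In this
parametrisation `UnitAddTorus.mFourier k y = exp (2πi k·y) = exp (i k·x)`, and all derivatives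
below are derivatives in `x`, so that `∂ⱼ` has Fourier symbol `i kⱼ`. -/
abbrev T3 : Type := UnitAddTorus (Fin 3)

/-- Normalised Haar measure on the torus, i.e. `(2π)⁻³ dx`. -/
abbrev haar3 : Measure T3 := Measure.pi fun _ => AddCircle.haarAddCircle

/-- Frequencies; the components `k₁, k₂, k₃` are `k 0, k 1, k 2`. -/
abbrev Freq : Type := Fin 3 → ℤ

/-- Fourier coefficient `ĝ(k) = (2π)⁻³ ∫ g(x) exp (-i k·x) dx`. -/
def coeff (g : T3 → ℂ) (k : Freq) : ℂ := ∫ y, UnitAddTorus.mFourier (-k) y * g y ∂haar3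

/-- Fourier coefficient of a real function. -/
def rcoeff (f : T3 → ℝ) (k : Freq) : ℂ := coeff (fun y => (f y : ℂ)) k

/-- `|k|²`. -/
def normSq (k : Freq) : ℝ := ∑ i, (k i : ℝ) ^ 2

/-! ### Sobolev spaces on the torus -/

/-- `g = m(D) f` in the sense of distributions, for integrable functions `f`, `g`:
`ĝ(k) = m(k) f̂(k)` for all `k`. For `m(k) = i kⱼ` it says that `g` is the weak derivative
`∂ⱼ f`, namely `∫ g φ = -∫ f ∂ⱼφ` for all trigonometric polynomials `φ` (equivalently, as these
are dense in `C^∞(𝕋³)`, for all smooth `φ`). -/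
def IsMultiplier (m : Freq → ℂ) (f : T3 → ℝ) (g : T3 → ℂ) : Prop :=
  Integrable f haar3 ∧ Integrable g haar3 ∧ ∀ k, coeff g k = m k * rcoeff f k

/-- The value `Q (m(D) f)`. As `m(D) f` is unique up to null sets, the infimum is over
one class of a.e. equal functions, or over the empty set, and then the value is `∞`. -/
def multEval (Q : (T3 → ℂ) → ℝ≥0∞) (m : Freq → ℂ) (f : T3 → ℝ) : ℝ≥0∞ :=
  ⨅ (g : T3 → ℂ) (_ : IsMultiplier m f g), Q g

/-- Symbol `(ik)^α` of the partial derivative `∂^α`. -/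
def derivSymbol (α : Fin 3 → ℕ) (k : Freq) : ℂ := ∏ i, (Complex.I * (k i : ℂ)) ^ α i

/-- The multi-indices `α` with `|α| = m`. -/
def multiIndex (m : ℕ) : Finset (Fin 3 → ℕ) := Finset.piAntidiag Finset.univ m

/-- The `L^p` norm. -/
def lpENorm (p : ℝ≥0∞) (g : T3 → ℂ) : ℝ≥0∞ := eLpNorm g p haar3

/-- The Gagliardo seminorm `(∬ |g(x) - g(x')|^p / |x - x'|^(3 + σp) dx dx')^(1/p)`. -/
def gagliardo (σ : ℝ) (p : ℝ≥0∞) (g : T3 → ℂ) : ℝ≥0∞ :=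
  (∫⁻ x, ∫⁻ x', ‖g x - g x'‖ₑ ^ p.toReal / edist x x' ^ (3 + σ * p.toReal) ∂haar3 ∂haar3)
    ^ (1 / p.toReal)

/-- Symbol `(1 + |k|²)^(s/2)` of the Bessel potential `(1 - Δ)^(s/2)`. -/
def besselSymbol (s : ℝ) (k : Freq) : ℂ := (((1 + normSq k) ^ (s / 2) : ℝ) : ℂ)

/-- The Sobolev norm of `W^{n,p}`: the sum of `‖∂^α f‖_{L^p}` over `|α| ≤ n`. -/
def intSobolevNorm (n : ℕ) (p : ℝ≥0∞) (f : T3 → ℝ) : ℝ≥0∞ :=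
  ∑ m ∈ Finset.range (n + 1), ∑ α ∈ multiIndex m, multEval (lpENorm p) (derivSymbol α) f

/-- The Sobolev spaces of real functions on the torus. -/
inductive SobolevSpace : Type
  /-- `W^{n,p}`, with `n ∈ ℕ` and `1 ≤ p ≤ ∞`. -/
  | integer (n : ℕ) (p : ℝ≥0∞) (hp : 1 ≤ p)
  /-- The Bessel potential space `H^{s,p}`, with `s ∈ ℝ` and `1 < p < ∞`; `H^{s,2} = H^s`. -/
  | bessel (s : ℝ) (p : ℝ≥0∞) (hp : 1 < p) (hp' : p < ∞)
  /-- The Sobolev–Slobodeckij space `W^{n+σ,p}`, with `n ∈ ℕ`, `0 < σ < 1`, `1 ≤ p < ∞`. -/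
  | slobodeckij (n : ℕ) (σ : ℝ) (hσ : 0 < σ) (hσ' : σ < 1) (p : ℝ≥0∞) (hp : 1 ≤ p) (hp' : p < ∞)

/-- The norm of a Sobolev space, with the value `∞` on integrable functions outside the space
and on functions that are not integrable. -/
def SobolevSpace.eNorm : SobolevSpace → (T3 → ℝ) → ℝ≥0∞
  | .integer n p _, f => intSobolevNorm n p f
  | .bessel s p _ _, f => multEval (lpENorm p) (besselSymbol s) f
  | .slobodeckij n σ _ _ p _ _, f =>
      intSobolevNorm n p f + ∑ α ∈ multiIndex n, multEval (gagliardo σ p) (derivSymbol α) f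

/-- The function `f` belongs to the Sobolev space `X`. -/
def SobolevSpace.Mem (X : SobolevSpace) (f : T3 → ℝ) : Prop := X.eNorm f < ∞

/-- Continuous embedding `Y ⊂ X`. -/
def SobolevSpace.Embeds (Y X : SobolevSpace) : Prop :=
  ∃ C : ℝ≥0, ∀ f : T3 → ℝ, X.eNorm f ≤ C * Y.eNorm f

/-- The space `W^{1,4}(𝕋³)`. -/
def W14 : SobolevSpace := .integer 1 4 (by norm_num)

/-! ### The magnetogeostrophic equation -/

/-- `D(k) = N⁴ |k|² k₃² + k₂⁴`. -/
def symbolD (N : ℝ) (k : Freq) : ℝ := N ^ 4 * normSq k * (k 2 : ℝ) ^ 2 + (k 1 : ℝ) ^ 4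

/-- The symbols `M̂₁, M̂₂, M̂₃` (here with indices `0, 1, 2`), which vanish on `{k₃ = 0}`. -/
def symbolM (N : ℝ) (j : Fin 3) (k : Freq) : ℝ :=
  if k 2 = 0 then 0
  else
    (![N ^ 4 * (k 1 : ℝ) * (k 2 : ℝ) * normSq k
          - N ^ 2 * (k 0 : ℝ) * (k 1 : ℝ) ^ 2 * (k 2 : ℝ),
       -(N ^ 4 * (k 0 : ℝ) * (k 2 : ℝ) * normSq k) - N ^ 2 * (k 1 : ℝ) ^ 3 * (k 2 : ℝ),
       N ^ 2 * (k 0 : ℝ) ^ 2 * (k 1 : ℝ) ^ 2 + N ^ 2 * (k 1 : ℝ) ^ 4] j) / symbolD N k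

/-- `m(D) f` as an element of `L²`, given by its Fourier series `∑ₖ m(k) f̂(k) e_k`, which
converges unconditionally in `L²` when `m f̂ ∈ ℓ²`. It is used for `m(k) = O(|k|)` and
`f ∈ W^{1,4} ⊂ H¹` only. -/
def multL2 (m : Freq → ℂ) (f : T3 → ℝ) : Lp ℂ 2 haar3 :=
  ∑' k : Freq, (m k * rcoeff f k) • ContinuousMap.toLp 2 haar3 ℂ (UnitAddTorus.mFourier k)

/-- The velocity component `u_j = M_j[f]`. -/
def velocity (N : ℝ) (f : T3 → ℝ) (j : Fin 3) : Lp ℂ 2 haar3 :=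
  multL2 (fun k => (symbolM N j k : ℂ)) f

/-- The partial derivative `∂_j f`. -/
def partialDeriv (f : T3 → ℝ) (j : Fin 3) : Lp ℂ 2 haar3 :=
  multL2 (fun k => Complex.I * (k j : ℂ)) f

/-- The nonlinear term `M[f] · ∇f`. -/
def advection (N : ℝ) (f : T3 → ℝ) (y : T3) : ℂ :=
  ∑ j, velocity N f j y * partialDeriv f j y

/-- `f` has zero vertical mean: `∫ f dx₃ = 0` for almost every `(x₁, x₂)`. -/
def ZeroVerticalMean (f : T3 → ℝ) : Prop :=
  ∀ᵐ y ∂haar3, ∫ s, f (Function.update y 2 s) ∂AddCircle.haarAddCircle = 0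

/-- `θ ∈ L^∞(0,T;X)` solves `∂ₜθ + M[θ]·∇θ = 0`, `θ(0) = θ₀`, in the sense of distributions,
integrated in time and tested with the exponentials `exp (-i k·x)`:
`θ̂(t,k) = θ̂₀(k) - ∫₀ᵗ (M[θ]·∇θ)^(s,k) ds` for all `k` and a.e. `t ∈ (0,T)`. -/
structure IsSolution (N : ℝ) (X : SobolevSpace) (T : ℝ) (θ₀ : T3 → ℝ) (θ : ℝ → T3 → ℝ) :
    Prop where
  measurable : AEStronglyMeasurable (Function.uncurry θ)
    ((volume.restrict (Ioo 0 T)).prod haar3)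
  bounded : ∃ C : ℝ≥0, ∀ᵐ t ∂volume.restrict (Ioo 0 T), X.eNorm (θ t) ≤ C
  integrable : ∀ k, IntegrableOn (fun s => coeff (advection N (θ s)) k) (Ioo 0 T)
  equation : ∀ k, ∀ᵐ t ∂volume.restrict (Ioo 0 T),
    rcoeff (θ t) k = rcoeff θ₀ k - ∫ s in (0 : ℝ)..t, coeff (advection N (θ s)) k

/-- `θ` is the unique solution in `L^∞(0,T;X)` with initial datum `θ₀`. -/
def IsUniqueSolution (N : ℝ) (X : SobolevSpace) (T : ℝ) (θ₀ : T3 → ℝ) (θ : ℝ → T3 → ℝ) :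
    Prop :=
  IsSolution N X T θ₀ θ ∧
    ∀ θ' : ℝ → T3 → ℝ, IsSolution N X T θ₀ θ' →
      ∀ᵐ t ∂volume.restrict (Ioo 0 T), θ' t =ᵐ[haar3] θ t

/-- Local Lipschitz `(X,Y)` well-posedness of the Cauchy problem for the non-diffusive MG
equation. The existence time `T` and the Lipschitz constant `K` are continuous positive
functions of the `Y` norms of the two initial data, which have zero vertical mean. Elements of
`L^∞(0,T;X)` being classes, the Lipschitz bound is required for a.e. `t`. -/
def LipschitzWellPosed (N : ℝ) (X Y : SobolevSpace) : Prop :=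
  ∃ T K : ℝ≥0 × ℝ≥0 → ℝ, Continuous T ∧ Continuous K ∧ (∀ a, 0 < T a) ∧ (∀ a, 0 < K a) ∧
    ∀ f₁ f₂ : T3 → ℝ, Y.Mem f₁ → Y.Mem f₂ → ZeroVerticalMean f₁ → ZeroVerticalMean f₂ →
      let a : ℝ≥0 × ℝ≥0 := ((Y.eNorm f₁).toNNReal, (Y.eNorm f₂).toNNReal)
      ∃ θ₁ θ₂ : ℝ → T3 → ℝ,
        IsUniqueSolution N X (T a) f₁ θ₁ ∧ IsUniqueSolution N X (T a) f₂ θ₂ ∧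
        ∀ᵐ t ∂volume.restrict (Ioo 0 (T a)),
          X.eNorm (θ₁ t - θ₂ t) ≤ ENNReal.ofReal (K a) * Y.eNorm (f₁ - f₂)

end MG

end

open MeasureTheory Set
open scoped ENNReal NNReal

noncomputable section

namespace MG

/-! The function `-sin (2 x₃)` is a steady state, because all three symbols vanish at `(0, 0, ±2)`.
Its vertical derivative is `-(exp (2i x₃) + exp (-2i x₃))`, so linearising there couples the Fourier
coefficients along a vertical line of frequencies `(k₁, k₂, n)` by `aₙ' = μₙ₋₂ aₙ₋₂ + μₙ₊₂ aₙ₊₂`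
with `μₙ = M̂₃(k₁, k₂, n) ≥ 0`. On the line `(K², K, n)` both terms of `D` have size `K⁴` at `n =
±1`. There `μₙ` has order `K²`, while `μₙ ≤ K²/N²` for all `n`. A perturbation started at `n = 1`
therefore grows like `exp (c K² t)`, whereas a Lipschitz bound between Sobolev spaces only allows
the loss of a fixed power of `K`.

The nonlinear term is controlled by the assumed well-posedness itself. The solution starting from
the steady state plus `2 ε cos (k·x)` stays within `ε B` of the steady state in `W^{1,4}`, with `B`
polynomial in `K` (`trigBounded_eNorm`). As `M` has order one, the quadratic term has Fourier
coefficients `O(ε² B²)` by Cauchy–Schwarz (`norm_coeff_advection_add_le`). Iterating Duhamel's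
formula `J` times compares the solution with a Taylor polynomial of the linear flow
(`norm_sub_taylor_le`). After division by `ε`, the limits `ε → 0` and then `J → ∞`, together with
positivity of the Taylor terms, bound each single term by `B`
(`exists_iter_le_of_lipschitzWellPosed`). With `B` of order `K^(2s)`, the term of degree `2(s+1)`,
at least of order `K^(4(s+1))` by `pow_le_iter`, gives a contradiction. -/

/-! ### Fourier coefficients and multipliers in `L²` -/

/-- The exponentials as a Hilbert basis of `L²`. -/
def expBasis : HilbertBasis Freq ℂ (Lp ℂ 2 haar3) := UnitAddTorus.mFourierBasis

theorem expBasis_apply (k : Freq) :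
    expBasis k = ContinuousMap.toLp 2 haar3 ℂ (UnitAddTorus.mFourier k) :=
  congrFun UnitAddTorus.coe_mFourierBasis k

theorem expBasis_repr (f : Lp ℂ 2 haar3) (k : Freq) : expBasis.repr f k = coeff f k :=
  UnitAddTorus.mFourierBasis_repr f k

theorem coeff_congr {f g : T3 → ℂ} (h : f =ᵐ[haar3] g) (k : Freq) : coeff f k = coeff g k :=
  integral_congr_ae (by filter_upwards [h] with y hy; rw [hy])

theorem norm_mFourier_apply (k : Freq) (y : T3) : ‖UnitAddTorus.mFourier k y‖ = 1 := by
  simp only [UnitAddTorus.mFourier, fourier_apply, ContinuousMap.coe_mk, norm_prod, Circle.norm_coe,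
    Finset.prod_const_one]

theorem integrable_mFourier_mul {f : T3 → ℂ} (hf : Integrable f haar3) (k : Freq) :
    Integrable (fun y => UnitAddTorus.mFourier k y * f y) haar3 :=
  hf.bdd_mul (c := 1) (UnitAddTorus.mFourier k).continuous.aestronglyMeasurable
    (Filter.Eventually.of_forall fun y => (norm_mFourier_apply k y).le)

theorem integrable_of_continuous {f : T3 → ℂ} (hf : Continuous f) : Integrable f haar3 :=
  hf.integrable_of_hasCompactSupport (HasCompactSupport.of_compactSpace f)

theorem coeff_add {f g : T3 → ℂ} (hf : Integrable f haar3) (hg : Integrable g haar3) (k : Freq) :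
    coeff (fun y => f y + g y) k = coeff f k + coeff g k := by
  simp only [coeff, mul_add]
  exact integral_add (integrable_mFourier_mul hf _) (integrable_mFourier_mul hg _)

theorem coeff_sub {f g : T3 → ℂ} (hf : Integrable f haar3) (hg : Integrable g haar3) (k : Freq) :
    coeff (fun y => f y - g y) k = coeff f k - coeff g k := by
  simp only [coeff, mul_sub]
  exact integral_sub (integrable_mFourier_mul hf _) (integrable_mFourier_mul hg _)

theorem coeff_sum {ι : Type*} (s : Finset ι) {f : ι → T3 → ℂ}
    (hf : ∀ i ∈ s, Integrable (f i) haar3) (k : Freq) :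
    coeff (fun y => ∑ i ∈ s, f i y) k = ∑ i ∈ s, coeff (f i) k := by
  simp only [coeff, Finset.mul_sum]
  exact integral_finsetSum _ fun i hi => integrable_mFourier_mul (hf i hi) _

theorem coeff_const_mul (c : ℂ) (f : T3 → ℂ) (k : Freq) :
    coeff (fun y => c * f y) k = c * coeff f k := by
  simp only [coeff, mul_left_comm _ c]
  exact integral_const_mul _ _

theorem coeff_mFourier_mul (l : Freq) (f : T3 → ℂ) (k : Freq) :
    coeff (fun y => UnitAddTorus.mFourier l y * f y) k = coeff f (k - l) := by
  refine integral_congr_ae (Filter.Eventually.of_forall fun y => ?_)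
  simp only [← mul_assoc, ← UnitAddTorus.mFourier_add]
  congr 3; abel

theorem coeff_mFourier (l k : Freq) :
    coeff (UnitAddTorus.mFourier l) k = if k = l then 1 else 0 := by
  rw [← coeff_congr (ContinuousMap.coeFn_toLp (p := 2) (𝕜 := ℂ) haar3 (UnitAddTorus.mFourier l)),
    ← expBasis_repr, ← expBasis_apply, HilbertBasis.repr_self]
  simp [Pi.single_apply]

/-- A trigonometric polynomial. -/
def trigPoly {ι : Type} [Fintype ι] (κ : ι → Freq) (c : ι → ℂ) (y : T3) : ℂ :=
  ∑ i, c i * UnitAddTorus.mFourier (κ i) y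

theorem continuous_trigPoly {ι : Type} [Fintype ι] (κ : ι → Freq) (c : ι → ℂ) :
    Continuous (trigPoly κ c) := by
  unfold trigPoly; fun_prop

theorem coeff_trigPoly {ι : Type} [Fintype ι] (κ : ι → Freq) (c : ι → ℂ) (k : Freq) :
    coeff (trigPoly κ c) k = ∑ i, c i * if k = κ i then 1 else 0 := by
  unfold trigPoly
  rw [coeff_sum _ fun i _ => integrable_of_continuous (by fun_prop)]
  simp only [coeff_const_mul, coeff_mFourier]

theorem norm_coeff_le {f : T3 → ℂ} (hf : Integrable f haar3) (k : Freq) :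
    ‖coeff f k‖ ≤ (eLpNorm f 1 haar3).toReal := by
  refine (norm_integral_le_integral_norm _).trans ?_
  rw [integral_norm_eq_lintegral_enorm (integrable_mFourier_mul hf _).1, eLpNorm_one_eq_lintegral_enorm]
  refine le_of_eq (congrArg _ (lintegral_congr fun y => ?_))
  rw [enorm_mul, ← ofReal_norm, norm_mFourier_apply]; simp

theorem integrable_mul_of_L2 (V W : Lp ℂ 2 haar3) : Integrable (fun y => V y * W y) haar3 :=
  (Lp.memLp V).integrable_mul (Lp.memLp W)

theorem norm_coeff_mul_le (V W : Lp ℂ 2 haar3) (k : Freq) :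
    ‖coeff (fun y => V y * W y) k‖ ≤ ‖V‖ * ‖W‖ := by
  refine (norm_coeff_le (integrable_mul_of_L2 V W) k).trans ?_
  rw [Lp.norm_def, Lp.norm_def, ← ENNReal.toReal_mul]
  refine ENNReal.toReal_mono (ENNReal.mul_ne_top (Lp.eLpNorm_ne_top V) (Lp.eLpNorm_ne_top W)) ?_
  have h := eLpNorm_smul_le_mul_eLpNorm (p := 2) (q := 2) (r := 1) (f := fun y => W y)
    (φ := fun y => V y) (Lp.memLp W).1 (Lp.memLp V).1
  exact h

/-- Square summability of `m f̂`. -/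
def SqSummable (m : Freq → ℂ) (f : T3 → ℝ) : Prop := Summable fun k => ‖m k * rcoeff f k‖ ^ 2

theorem SqSummable.memℓp {m : Freq → ℂ} {f : T3 → ℝ} (h : SqSummable m f) :
    Memℓp (fun k => m k * rcoeff f k) 2 :=
  memℓp_gen (by simpa [SqSummable] using h)

/-- The sequence `m f̂` in `ℓ²`. -/
def SqSummable.seq {m : Freq → ℂ} {f : T3 → ℝ} (h : SqSummable m f) : lp (fun _ : Freq => ℂ) 2 :=
  ⟨fun k => m k * rcoeff f k, h.memℓp⟩

theorem SqSummable.seq_apply {m : Freq → ℂ} {f : T3 → ℝ} (h : SqSummable m f) (k : Freq) :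
    h.seq k = m k * rcoeff f k := rfl

/-- Orthonormality turns square summability into convergence of the series in `multL2`; a divergent
series would have the default value `0`. -/
theorem SqSummable.hasSum {m : Freq → ℂ} {f : T3 → ℝ} (h : SqSummable m f) :
    HasSum (fun k => (m k * rcoeff f k) • ContinuousMap.toLp 2 haar3 ℂ (UnitAddTorus.mFourier k))
      (expBasis.repr.symm h.seq) := by
  have h2 := expBasis.hasSum_repr_symm h.seq
  simp only [expBasis_apply, h.seq_apply] at h2
  exact h2

theorem multL2_eq {m : Freq → ℂ} {f : T3 → ℝ} (h : SqSummable m f) :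
    multL2 m f = expBasis.repr.symm h.seq := h.hasSum.tsum_eq

theorem coeff_multL2 {m : Freq → ℂ} {f : T3 → ℝ} (h : SqSummable m f) (k : Freq) :
    coeff (multL2 m f) k = m k * rcoeff f k := by
  rw [← expBasis_repr, multL2_eq h, LinearIsometryEquiv.apply_symm_apply, h.seq_apply]

theorem norm_sq_multL2 {m : Freq → ℂ} {f : T3 → ℝ} (h : SqSummable m f) :
    ‖multL2 m f‖ ^ 2 = ∑' k, ‖m k * rcoeff f k‖ ^ 2 := by
  rw [multL2_eq h, LinearIsometryEquiv.norm_map]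
  simpa [h.seq_apply] using lp.norm_rpow_eq_tsum (p := 2) (by norm_num) h.seq

theorem multL2_add {m : Freq → ℂ} {f g h : T3 → ℝ} (hf : SqSummable m f) (hg : SqSummable m g)
    (hh : ∀ k, rcoeff h k = rcoeff f k + rcoeff g k) : multL2 m h = multL2 m f + multL2 m g := by
  rw [multL2, multL2, multL2, ← hf.hasSum.summable.tsum_add hg.hasSum.summable]
  simp only [hh, mul_add, add_smul]

theorem summable_and_tsum_sq_coeff {g : T3 → ℂ} (hg : MemLp g 2 haar3) :
    Summable (fun k => ‖coeff g k‖ ^ 2) ∧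
      ∑' k, ‖coeff g k‖ ^ 2 = (eLpNorm g 2 haar3).toReal ^ 2 := by
  have h1 : ∀ k, coeff g k = expBasis.repr (hg.toLp g) k := fun k => by
    rw [expBasis_repr]; exact coeff_congr hg.coeFn_toLp.symm k
  have h2 := lp.hasSum_norm (p := 2) (by norm_num) (expBasis.repr (hg.toLp g))
  simp only [ENNReal.toReal_ofNat, Real.rpow_ofNat, LinearIsometryEquiv.norm_map,
    Lp.norm_toLp, ← h1] at h2
  exact ⟨h2.summable, h2.tsum_eq⟩

/-! ### Fourier-side consequences of a `W^{1,4}` bound -/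

theorem exists_isMultiplier_of_multEval_lt {Q : (T3 → ℂ) → ℝ≥0∞} {m : Freq → ℂ} {f : T3 → ℝ}
    {b : ℝ≥0∞} (h : multEval Q m f < b) : ∃ g, IsMultiplier m f g ∧ Q g < b := by
  simpa [multEval, iInf_lt_iff] using h

/-- A bound `B` for the `L⁴` norm of `m(D) f`, on the Fourier side. -/
structure FourierBound (m : Freq → ℂ) (f : T3 → ℝ) (B : ℝ) : Prop where
  coeff_le : ∀ k, ‖m k * rcoeff f k‖ ≤ B
  sqSummable : SqSummable m f
  tsum_le : ∑' k, ‖m k * rcoeff f k‖ ^ 2 ≤ B ^ 2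

/-- The torus has measure one, so the `L¹` and `L²` norms are at most the `L⁴` norm. The first
bounds single coefficients, the second their square sum by Parseval. -/
theorem fourierBound_of_multEval_lt {m : Freq → ℂ} {f : T3 → ℝ} {B : ℝ}
    (h : multEval (lpENorm 4) m f < ENNReal.ofReal B) : FourierBound m f B := by
  obtain ⟨g, ⟨-, hg, hgk⟩, hgB⟩ := exists_isMultiplier_of_multEval_lt h
  have hB : 0 ≤ B := by
    by_contra hneg
    simp [ENNReal.ofReal_of_nonpos (not_le.mp hneg).le] at hgB
  have hle : ∀ p : ℝ≥0∞, p ≤ 4 → eLpNorm g p haar3 ≤ ENNReal.ofReal B := fun p hp =>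
    (eLpNorm_le_eLpNorm_of_exponent_le hp hg.1).trans hgB.le
  have h1 := hle 1 (by norm_num)
  have h2 := hle 2 (by norm_num)
  obtain ⟨hs, ht⟩ := summable_and_tsum_sq_coeff (g := g) ⟨hg.1, h2.trans_lt ENNReal.ofReal_lt_top⟩
  simp only [hgk] at hs ht
  refine ⟨fun k => ?_, hs, ?_⟩
  · rw [← hgk]
    exact (norm_coeff_le hg k).trans (ENNReal.toReal_le_of_le_ofReal hB h1)
  · rw [ht]
    exact pow_le_pow_left₀ ENNReal.toReal_nonneg (ENNReal.toReal_le_of_le_ofReal hB h2) 2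

/-- The strict version yields a representative for every `b > B`; the bounds survive as `b`
decreases to `B`. -/
theorem fourierBound_of_multEval_le {m : Freq → ℂ} {f : T3 → ℝ} {B : ℝ} (hB : 0 ≤ B)
    (h : multEval (lpENorm 4) m f ≤ ENNReal.ofReal B) : FourierBound m f B := by
  have key : ∀ b, B < b → FourierBound m f b := fun b hb =>
    fourierBound_of_multEval_lt (h.trans_lt ((ENNReal.ofReal_lt_ofReal_iff (hB.trans_lt hb)).2 hb))
  refine ⟨fun k => le_of_forall_gt_imp_ge_of_dense fun b hb => (key b hb).coeff_le k,
    (key (B + 1) (by linarith)).sqSummable, ?_⟩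
  refine (Real.sqrt_le_left hB).1 (le_of_forall_gt_imp_ge_of_dense fun b hb => ?_)
  exact (Real.sqrt_le_left (hB.trans hb.le)).2 (key b hb).tsum_le

theorem multEval_le_intSobolevNorm {n : ℕ} {p : ℝ≥0∞} {f : T3 → ℝ} {m : ℕ} (hm : m ≤ n)
    {α : Fin 3 → ℕ} (hα : ∑ i, α i = m) :
    multEval (lpENorm p) (derivSymbol α) f ≤ intSobolevNorm n p f := by
  refine le_trans ?_ (Finset.single_le_sum (f := fun m => ∑ α ∈ multiIndex m,
    multEval (lpENorm p) (derivSymbol α) f) (fun _ _ => zero_le) (Finset.mem_range_succ_iff.2 hm))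
  exact Finset.single_le_sum (f := fun α => multEval (lpENorm p) (derivSymbol α) f)
    (fun _ _ => zero_le) (by simp [multiIndex, hα])

theorem derivSymbol_zero : derivSymbol 0 = fun _ => 1 := by
  ext k; simp [derivSymbol]

theorem derivSymbol_single (j : Fin 3) :
    derivSymbol (Pi.single j 1) = fun k => Complex.I * (k j : ℂ) := by
  ext k
  rw [derivSymbol, Finset.prod_eq_single j] <;> simp +contextual

theorem integrable_of_W14 {f : T3 → ℝ} (h : W14.eNorm f < ∞) : Integrable f haar3 := by
  have h0 : multEval (lpENorm 4) (derivSymbol 0) f < ∞ :=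
    (multEval_le_intSobolevNorm (m := 0) zero_le (by simp)).trans_lt h
  obtain ⟨g, hg, -⟩ := exists_isMultiplier_of_multEval_lt h0
  exact hg.1

theorem norm_rcoeff_le_of_W14 {f : T3 → ℝ} {B : ℝ} (hB : 0 ≤ B)
    (h : W14.eNorm f ≤ ENNReal.ofReal B) (k : Freq) : ‖rcoeff f k‖ ≤ B := by
  have h0 : multEval (lpENorm 4) (derivSymbol 0) f ≤ ENNReal.ofReal B :=
    (multEval_le_intSobolevNorm (m := 0) zero_le (by simp)).trans h
  simpa [derivSymbol_zero] using (fourierBound_of_multEval_le hB h0).coeff_le k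

theorem fourierBound_deriv_of_W14 {f : T3 → ℝ} {B : ℝ} (hB : 0 ≤ B)
    (h : W14.eNorm f ≤ ENNReal.ofReal B) (j : Fin 3) :
    FourierBound (fun k => Complex.I * (k j : ℂ)) f B := by
  rw [← derivSymbol_single]
  exact fourierBound_of_multEval_le hB
    ((multEval_le_intSobolevNorm (m := 1) le_rfl (by simp)).trans h)

/-! ### The symbols have order one -/

theorem normSq_eq (k : Freq) : normSq k = (k 0 : ℝ) ^ 2 + (k 1 : ℝ) ^ 2 + (k 2 : ℝ) ^ 2 := by
  simp [normSq, Fin.sum_univ_three]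

theorem one_le_sq_of_ne_zero {n : ℤ} (h : n ≠ 0) : (1 : ℝ) ≤ (n : ℝ) ^ 2 := by
  have : (1 : ℤ) ≤ n ^ 2 := by nlinarith [sq_nonneg n, pow_pos (abs_pos.2 h) 2, sq_abs n]
  exact_mod_cast this

theorem symbolD_pos {N : ℝ} (hN : 0 < N) {k : Freq} (h : k 2 ≠ 0) : 0 < symbolD N k := by
  have h2 := one_le_sq_of_ne_zero h
  have h1 : 0 < normSq k := by rw [normSq_eq]; positivity
  unfold symbolD; positivity

/-- Here `a = N²`, `(x, b, c) = k` and `r = |k|`. Two lower bounds for `D = a² r² c² + b⁴` suffice: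
`a² r² |c| ≤ D`, since `|c| ≤ c²`, and `a r |c| b² ≤ D / 2`, by the inequality of arithmetic and
geometric means. -/
theorem abs_numerators_le {a b c x n r D : ℝ} (ha : 0 < a) (hr : 1 ≤ r) (hc : 1 ≤ |c|)
    (hn : n = r ^ 2) (hx : |x| ≤ r) (hb : |b| ≤ r) (hxb : x ^ 2 + b ^ 2 ≤ r ^ 2)
    (hD : D = a ^ 2 * n * c ^ 2 + b ^ 4) :
    |a ^ 2 * b * c * n - a * x * b ^ 2 * c| ≤ 2 * r * D ∧
    |-(a ^ 2 * x * c * n) - a * b ^ 3 * c| ≤ 2 * r * D ∧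
    |a * x ^ 2 * b ^ 2 + a * b ^ 4| ≤ 2 * r * D := by
  have hr0 : 0 ≤ r := by linarith
  have hc0 : 0 ≤ |c| := by linarith
  have hcc : |c| ≤ c ^ 2 := by rw [← sq_abs]; nlinarith
  have hD2 : a * r * |c| * b ^ 2 ≤ D / 2 := by
    rw [hD, hn, ← sq_abs c]; nlinarith [sq_nonneg (a * r * |c| - b ^ 2)]
  have hD1 : a ^ 2 * r ^ 2 * |c| ≤ D := by
    rw [hD, hn]
    have := mul_le_mul_of_nonneg_left hcc (by positivity : 0 ≤ a ^ 2 * r ^ 2)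
    nlinarith [pow_nonneg (sq_nonneg b) 2]
  have hD0 : 0 ≤ D := le_trans (by positivity) hD1
  have hrD : D ≤ r * D := by nlinarith
  have main : ∀ z, |z| ≤ r → a ^ 2 * |z| * |c| * r ^ 2 ≤ r * D := fun z hz =>
    calc a ^ 2 * |z| * |c| * r ^ 2 = |z| * (a ^ 2 * r ^ 2 * |c|) := by ring
      _ ≤ r * D := mul_le_mul hz hD1 (by positivity) hr0
  have minor : ∀ z, |z| ≤ r → a * |z| * b ^ 2 * |c| ≤ r * D := fun z hz =>
    calc a * |z| * b ^ 2 * |c| = |z| * (a * b ^ 2 * |c|) := by ring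
      _ ≤ r * (a * b ^ 2 * |c|) := mul_le_mul_of_nonneg_right hz (by positivity)
      _ = a * r * |c| * b ^ 2 := by ring
      _ ≤ r * D := by linarith
  refine ⟨?_, ?_, ?_⟩
  · refine (abs_sub _ _).trans ?_
    have h1 := main b hb
    have h2 := minor x hx
    have e1 : |a ^ 2 * b * c * n| = a ^ 2 * |b| * |c| * r ^ 2 := by
      rw [hn]; simp only [abs_mul, abs_pow, abs_of_pos ha, abs_of_nonneg hr0]
    have e2 : |a * x * b ^ 2 * c| = a * |x| * b ^ 2 * |c| := by
      simp only [abs_mul, abs_of_pos ha, abs_sq]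
    rw [e1, e2]; linarith
  · refine (abs_sub _ _).trans ?_
    have h1 := main x hx
    have h2 := minor b hb
    have e1 : |-(a ^ 2 * x * c * n)| = a ^ 2 * |x| * |c| * r ^ 2 := by
      rw [hn]; simp only [abs_neg, abs_mul, abs_pow, abs_of_pos ha, abs_of_nonneg hr0]
    have e2 : |a * b ^ 3 * c| = a * |b| * b ^ 2 * |c| := by
      rw [pow_succ' b 2]; simp only [abs_mul, abs_of_pos ha, abs_sq]; ring
    rw [e1, e2]; linarith
  · rw [abs_of_nonneg (by positivity)]
    calc a * x ^ 2 * b ^ 2 + a * b ^ 4 = a * b ^ 2 * (x ^ 2 + b ^ 2) := by ring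
      _ ≤ a * b ^ 2 * r ^ 2 := mul_le_mul_of_nonneg_left hxb (by positivity)
      _ = r * (a * r * 1 * b ^ 2) := by ring
      _ ≤ r * (a * r * |c| * b ^ 2) := by gcongr
      _ ≤ r * (D / 2) := mul_le_mul_of_nonneg_left hD2 hr0
      _ ≤ 2 * r * D := by nlinarith

theorem sq_symbolM_le {N : ℝ} (hN : 0 < N) (j : Fin 3) (k : Freq) :
    symbolM N j k ^ 2 ≤ 4 * normSq k := by
  have hn0 : 0 ≤ normSq k := by rw [normSq_eq]; positivity
  unfold symbolM
  split_ifs with h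
  · simpa using hn0
  have h2 := one_le_sq_of_ne_zero h
  have hn1 : 1 ≤ normSq k := by rw [normSq_eq]; nlinarith [sq_nonneg (k 0 : ℝ), sq_nonneg (k 1 : ℝ)]
  have hD := symbolD_pos hN h
  set r := √(normSq k)
  have hr2 : normSq k = r ^ 2 := (Real.sq_sqrt hn0).symm
  have hr1 : 1 ≤ r := Real.one_le_sqrt.2 hn1
  have hle : ∀ i, |(k i : ℝ)| ≤ r := fun i => Real.abs_le_sqrt
    (Finset.single_le_sum (f := fun i => (k i : ℝ) ^ 2) (fun _ _ => sq_nonneg _) (Finset.mem_univ i))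
  obtain ⟨e0, e1, e2⟩ := abs_numerators_le (a := N ^ 2) (b := k 1) (c := k 2) (x := k 0)
    (n := normSq k) (r := r) (D := symbolD N k) (by positivity) hr1
    (by rwa [one_le_sq_iff_one_le_abs] at h2) hr2 (hle 0) (hle 1)
    (by rw [← hr2, normSq_eq]; nlinarith) (by rw [symbolD]; ring)
  rw [div_pow, div_le_iff₀ (by positivity), hr2, ← sq_abs,
    show 4 * r ^ 2 * symbolD N k ^ 2 = (2 * r * symbolD N k) ^ 2 by ring]
  refine pow_le_pow_left₀ (abs_nonneg _) ?_ 2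
  have key : ∀ (v : Fin 3 → ℝ) (R : ℝ), |v 0| ≤ R → |v 1| ≤ R → |v 2| ≤ R → |v j| ≤ R := by
    intro v R h0 h1 h2
    fin_cases j <;> assumption
  have hN4 : (N ^ 2) ^ 2 = N ^ 4 := by ring
  rw [hN4, hr2] at e0 e1
  exact key _ _ e0 e1 e2

theorem norm_symbolM_mul_sq_le {N : ℝ} (hN : 0 < N) (j : Fin 3) (k : Freq) (z : ℂ) :
    ‖(symbolM N j k : ℂ) * z‖ ^ 2 ≤ 4 * ∑ i, ‖Complex.I * (k i : ℂ) * z‖ ^ 2 := by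
  have h := mul_le_mul_of_nonneg_right (sq_symbolM_le hN j k) (sq_nonneg ‖z‖)
  simpa [mul_pow, normSq, Finset.sum_mul, Finset.mul_sum, mul_assoc] using h

theorem sqSummable_symbolM {N : ℝ} (hN : 0 < N) {f : T3 → ℝ} {B : ℝ}
    (h : ∀ i : Fin 3, FourierBound (fun k => Complex.I * (k i : ℂ)) f B) (j : Fin 3) :
    SqSummable (fun k => (symbolM N j k : ℂ)) f :=
  Summable.of_nonneg_of_le (fun _ => sq_nonneg _) (fun k => norm_symbolM_mul_sq_le hN j k _)
    ((summable_sum fun i _ => (h i).sqSummable).mul_left 4)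

theorem norm_velocity_le {N : ℝ} (hN : 0 < N) {f : T3 → ℝ} {B : ℝ} (hB : 0 ≤ B)
    (h : ∀ i : Fin 3, FourierBound (fun k => Complex.I * (k i : ℂ)) f B) (j : Fin 3) :
    ‖velocity N f j‖ ≤ 4 * B := by
  have hs := sqSummable_symbolM hN h j
  refine abs_le_of_sq_le_sq' ?_ (by positivity) |>.2
  have hsum : Summable fun k : Freq => ∑ i, ‖Complex.I * (k i : ℂ) * rcoeff f k‖ ^ 2 :=
    summable_sum fun i _ => (h i).sqSummable
  rw [velocity, norm_sq_multL2 hs]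
  refine (hs.tsum_le_tsum (fun k => norm_symbolM_mul_sq_le hN j k _) (hsum.mul_left 4)).trans ?_
  rw [tsum_mul_left, Summable.tsum_finsetSum fun i _ => (h i).sqSummable]
  have h3 := Finset.sum_le_sum fun i (_ : i ∈ (Finset.univ : Finset (Fin 3))) => (h i).tsum_le
  simp only [Finset.sum_const, Finset.card_univ, Fintype.card_fin, nsmul_eq_mul,
    Nat.cast_ofNat] at h3
  -- Three derivatives and the factor 4 give `12 B²`, which is rounded up to `(4 B)²`.
  nlinarith [sq_nonneg B]

theorem norm_partialDeriv_le {f : T3 → ℝ} {B : ℝ} (hB : 0 ≤ B) {j : Fin 3}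
    (h : FourierBound (fun k => Complex.I * (k j : ℂ)) f B) : ‖partialDeriv f j‖ ≤ B := by
  refine abs_le_of_sq_le_sq' ?_ hB |>.2
  rw [partialDeriv, norm_sq_multL2 h.sqSummable]
  exact h.tsum_le

/-! ### The steady state and the linearisation at it -/

/-- The real part of a trigonometric polynomial. -/
def reTrig {ι : Type} [Fintype ι] (κ : ι → Freq) (c : ι → ℂ) (y : T3) : ℝ := (trigPoly κ c y).re

theorem ofReal_reTrig {ι : Type} [Fintype ι] (κ : ι → Freq) (c : ι → ℂ) (y : T3) :
    ((reTrig κ c y : ℝ) : ℂ) = trigPoly (Sum.elim κ fun i => -κ i)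
      (Sum.elim (fun i => c i / 2) fun i => star (c i) / 2) y := by
  rw [reTrig, Complex.re_eq_add_conj, trigPoly, trigPoly, Fintype.sum_sum_type, map_sum, add_div,
    Finset.sum_div, Finset.sum_div]
  simp [UnitAddTorus.mFourier_neg, mul_div_right_comm]

theorem continuous_reTrig {ι : Type} [Fintype ι] (κ : ι → Freq) (c : ι → ℂ) :
    Continuous (reTrig κ c) := Complex.continuous_re.comp (continuous_trigPoly κ c)

theorem rcoeff_reTrig {ι : Type} [Fintype ι] (κ : ι → Freq) (c : ι → ℂ) (l : Freq) :
    rcoeff (reTrig κ c) l =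
      ∑ i, ((c i / 2 * if l = κ i then 1 else 0) + star (c i) / 2 * if l = -κ i then 1 else 0) := by
  rw [rcoeff, funext (ofReal_reTrig κ c), coeff_trigPoly, Fintype.sum_sum_type,
    ← Finset.sum_add_distrib]
  rfl

/-- The frequency `(0, 0, 2)` of the steady state. -/
def vert : Freq := ![0, 0, 2]

/-- The steady state `-sin (2 x₃)`, perturbed by `2 ε cos (k·x)`. -/
def datum (k : Freq) (ε : ℝ) : T3 → ℝ := reTrig ![vert, k] ![Complex.I, ((2 * ε : ℝ) : ℂ)]

/-- Fourier coefficients of `-sin (2 x₃)`. -/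
def steadyCoeff (l : Freq) : ℂ :=
  Complex.I / 2 * ((if l = vert then 1 else 0) - if l = -vert then 1 else 0)

/-- Fourier coefficients of `2 cos (k·x)`. -/
def cosCoeff (k l : Freq) : ℂ := (if l = k then 1 else 0) + if l = -k then 1 else 0

theorem rcoeff_datum (k : Freq) (ε : ℝ) (l : Freq) :
    rcoeff (datum k ε) l = steadyCoeff l + ε * cosCoeff k l := by
  rw [datum, rcoeff_reTrig, steadyCoeff, cosCoeff]
  rw [Fin.sum_univ_two]
  change (Complex.I / 2 * (if l = vert then 1 else 0) + star Complex.I / 2 *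
    (if l = -vert then 1 else 0)) + (((2 * ε : ℝ) : ℂ) / 2 * (if l = k then 1 else 0) +
    star ((2 * ε : ℝ) : ℂ) / 2 * (if l = -k then 1 else 0)) = _
  rw [Complex.star_def, Complex.conj_ofReal, Complex.conj_I]
  push_cast
  ring

theorem rcoeff_datum_zero (k : Freq) (l : Freq) : rcoeff (datum k 0) l = steadyCoeff l := by
  simp [rcoeff_datum]

theorem steadyCoeff_eq_zero {l : Freq} (h1 : l ≠ vert) (h2 : l ≠ -vert) : steadyCoeff l = 0 := by
  simp [steadyCoeff, h1, h2]

/-- At `(0, 0, ±2)` each term of each numerator has a factor `k₁` or `k₂`. -/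
theorem symbolM_mul_steadyCoeff (N : ℝ) (j : Fin 3) (l : Freq) :
    (symbolM N j l : ℂ) * steadyCoeff l = 0 := by
  by_cases h1 : l = vert
  · subst h1; fin_cases j <;> simp [symbolM, vert]
  by_cases h2 : l = -vert
  · subst h2; fin_cases j <;> simp [symbolM, vert]
  rw [steadyCoeff_eq_zero h1 h2, mul_zero]

theorem velocity_of_steadyCoeff (N : ℝ) (j : Fin 3) {F : T3 → ℝ}
    (hF : ∀ l, rcoeff F l = steadyCoeff l) : velocity N F j = 0 := by
  simp [velocity, multL2, hF, symbolM_mul_steadyCoeff]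

theorem coeff_advection_of_steadyCoeff (N : ℝ) {F : T3 → ℝ}
    (hF : ∀ l, rcoeff F l = steadyCoeff l) (k : Freq) : coeff (advection N F) k = 0 := by
  have h : advection N F = fun _ => 0 := funext fun y => by
    simp [advection, velocity_of_steadyCoeff N _ hF]
  simp [h, coeff]

theorem sqSummable_of_steadyCoeff (m : Freq → ℂ) {F : T3 → ℝ}
    (hF : ∀ l, rcoeff F l = steadyCoeff l) : SqSummable m F := by
  refine summable_of_ne_finset_zero (s := {vert, -vert}) fun l hl => ?_
  simp only [Finset.mem_insert, Finset.mem_singleton, not_or] at hl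
  simp [hF, steadyCoeff_eq_zero hl.1 hl.2]

/-- An element of `L²` is determined by its Fourier coefficients. -/
theorem ext_coeff {f g : Lp ℂ 2 haar3} (h : ∀ k, coeff f k = coeff g k) : f = g := by
  refine expBasis.repr.injective (lp.ext (funext fun k => ?_))
  rw [expBasis_repr, expBasis_repr, h]

theorem partialDeriv_steady {F : T3 → ℝ} (hF : ∀ l, rcoeff F l = steadyCoeff l) :
    partialDeriv F 2 =ᵐ[haar3] fun y =>
      (-1) * UnitAddTorus.mFourier vert y + (-1) * UnitAddTorus.mFourier (-vert) y := by
  have hc : Continuous fun y : T3 =>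
      (-1) * UnitAddTorus.mFourier vert y + (-1) * UnitAddTorus.mFourier (-vert) y := by fun_prop
  have hm : MemLp (fun y : T3 => (-1) * UnitAddTorus.mFourier vert y
      + (-1) * UnitAddTorus.mFourier (-vert) y) 2 haar3 :=
    hc.memLp_of_hasCompactSupport (HasCompactSupport.of_compactSpace _)
  suffices h : partialDeriv F 2 = hm.toLp _ by rw [h]; exact hm.coeFn_toLp
  refine ext_coeff fun k => ?_
  rw [coeff_congr hm.coeFn_toLp, partialDeriv, coeff_multL2 (sqSummable_of_steadyCoeff _ hF), hF,
    coeff_add (integrable_of_continuous (by fun_prop)) (integrable_of_continuous (by fun_prop)),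
    coeff_const_mul, coeff_const_mul, coeff_mFourier, coeff_mFourier]
  by_cases h1 : k = vert
  · subst h1
    simp [steadyCoeff, vert]
    linear_combination Complex.I_mul_I
  by_cases h2 : k = -vert
  · subst h2
    simp [steadyCoeff, vert]
    linear_combination Complex.I_mul_I
  simp [steadyCoeff_eq_zero h1 h2, h1, h2]

theorem partialDeriv_steady_of_ne {F : T3 → ℝ} (hF : ∀ l, rcoeff F l = steadyCoeff l) {j : Fin 3}
    (hj : vert j = 0) : partialDeriv F j = 0 := by
  have h : ∀ l : Freq, (Complex.I * (l j : ℂ)) * steadyCoeff l = 0 := fun l => by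
    by_cases h1 : l = vert
    · simp [h1, hj]
    by_cases h2 : l = -vert
    · simp [h2, hj]
    rw [steadyCoeff_eq_zero h1 h2, mul_zero]
  simp [partialDeriv, multL2, hF, h]

/-- The advection term at a perturbation `w` of the steady state is linear in `w` up to a
quadratic error. -/
theorem norm_coeff_advection_add_le {N : ℝ} (hN : 0 < N) {F θ w : T3 → ℝ} {B : ℝ} (hB : 0 ≤ B)
    (hF : ∀ l, rcoeff F l = steadyCoeff l) (hθ : ∀ l, rcoeff θ l = rcoeff F l + rcoeff w l)
    (hw : W14.eNorm w ≤ ENNReal.ofReal B) (k : Freq) :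
    ‖coeff (advection N θ) k + (symbolM N 2 (k - vert) * rcoeff w (k - vert)
      + symbolM N 2 (k + vert) * rcoeff w (k + vert))‖ ≤ 12 * B ^ 2 := by
  have hd := fourierBound_deriv_of_W14 hB hw
  have hM := sqSummable_symbolM hN hd
  have hvel : ∀ j, velocity N θ j = velocity N w j := fun j => by
    simp only [velocity, multL2, hθ, hF, mul_add, symbolM_mul_steadyCoeff, zero_add]
  have hpar : ∀ j, partialDeriv θ j = partialDeriv F j + partialDeriv w j := fun j =>
    multL2_add (sqSummable_of_steadyCoeff _ hF) (hd j).sqSummable hθ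
  -- Since `M[F] = 0`, the term is `M[w]·∇F + M[w]·∇w`, and `∇F` has only its vertical component.
  have hadv : advection N θ =ᵐ[haar3] fun y =>
      ((-1) * (UnitAddTorus.mFourier vert y * velocity N w 2 y)
        + (-1) * (UnitAddTorus.mFourier (-vert) y * velocity N w 2 y))
      + ∑ j, velocity N w j y * partialDeriv w j y := by
    filter_upwards [partialDeriv_steady hF, Lp.coeFn_add (partialDeriv F 2) (partialDeriv w 2)]
      with y h1 h2
    simp only [advection, hvel, Fin.sum_univ_three]
    rw [hpar 0, hpar 1, hpar 2, partialDeriv_steady_of_ne hF (j := 0) rfl,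
      partialDeriv_steady_of_ne hF (j := 1) rfl, zero_add, zero_add, h2, Pi.add_apply, h1]
    ring
  have hV : Integrable (velocity N w 2) haar3 := (Lp.memLp _).integrable (by norm_num)
  have hVe : ∀ l, Integrable (fun y => (-1) * (UnitAddTorus.mFourier l y * velocity N w 2 y))
      haar3 := fun l => (integrable_mFourier_mul hV l).const_mul _
  have hV2 : Integrable (fun y => (-1) * (UnitAddTorus.mFourier vert y * velocity N w 2 y)
      + (-1) * (UnitAddTorus.mFourier (-vert) y * velocity N w 2 y)) haar3 :=
    (hVe vert).add (hVe (-vert))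
  have hlin : ∀ l, coeff (velocity N w 2) l = symbolM N 2 l * rcoeff w l :=
    fun l => coeff_multL2 (hM 2) l
  rw [coeff_congr hadv, coeff_add hV2
    (integrable_finsetSum _ fun j _ => integrable_mul_of_L2 _ _), coeff_add (hVe _) (hVe _),
    coeff_const_mul, coeff_const_mul, coeff_mFourier_mul, coeff_mFourier_mul, hlin, hlin,
    sub_neg_eq_add, coeff_sum _ fun j _ => integrable_mul_of_L2 _ _]
  rw [show ∀ a b c : ℂ, -1 * a + -1 * b + c + (a + b) = c from fun a b c => by ring]
  refine (norm_sum_le _ _).trans ?_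
  -- The quadratic part has three products, each at most `(4 B) * B` by Cauchy–Schwarz.
  calc ∑ j, ‖coeff (fun y => velocity N w j y * partialDeriv w j y) k‖
      ≤ ∑ _j : Fin 3, 4 * B ^ 2 := Finset.sum_le_sum fun j _ => by
        refine (norm_coeff_mul_le _ _ _).trans ?_
        calc ‖velocity N w j‖ * ‖partialDeriv w j‖ ≤ (4 * B) * B :=
              mul_le_mul (norm_velocity_le hN hB hd j) (norm_partialDeriv_le hB (hd j))
                (norm_nonneg _) (by positivity)
          _ = 4 * B ^ 2 := by ring
    _ = 12 * B ^ 2 := by simp; ring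

/-! ### Zero vertical mean of the data -/

theorem integral_update_mFourier (k : Freq) (hk : k 2 ≠ 0) (y : T3) :
    ∫ s, UnitAddTorus.mFourier k (Function.update y 2 s) ∂AddCircle.haarAddCircle = 0 := by
  have h : ∀ s, UnitAddTorus.mFourier k (Function.update y 2 s)
      = (fourier (k 0) (y 0) * fourier (k 1) (y 1)) * fourier (k 2) s := fun s => by
    simp [UnitAddTorus.mFourier, Fin.prod_univ_three]
  simp only [h]
  -- Translation by half a period `1 / (2 k₃)` changes the sign of the last factor.
  rw [integral_const_mul, integral_eq_zero_of_add_right_eq_neg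
    (fourier_add_half_inv_index hk (by norm_num)), mul_zero]

theorem zeroVerticalMean_reTrig {ι : Type} [Fintype ι] (κ : ι → Freq) (c : ι → ℂ)
    (h : ∀ i, κ i 2 ≠ 0) : ZeroVerticalMean (reTrig κ c) := by
  refine Filter.Eventually.of_forall fun y => ?_
  have hc : ∀ i, Continuous fun s : UnitAddCircle =>
      c i * UnitAddTorus.mFourier (κ i) (Function.update y 2 s) := fun i => by
    have : Continuous fun s : UnitAddCircle => Function.update y 2 s :=
      continuous_const.update 2 continuous_id
    fun_prop
  have hi : ∀ i, Integrable (fun s : UnitAddCircle =>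
      c i * UnitAddTorus.mFourier (κ i) (Function.update y 2 s)) AddCircle.haarAddCircle :=
    fun i => (hc i).integrable_of_hasCompactSupport (HasCompactSupport.of_compactSpace _)
  simp only [reTrig, trigPoly]
  have := integral_re (𝕜 := ℂ) (integrable_finsetSum Finset.univ fun i _ => hi i)
  simp only [RCLike.re_eq_complex_re] at this
  rw [this, integral_finsetSum _ fun i _ => hi i]
  simp [integral_const_mul, integral_update_mFourier, h]

/-! ### Sobolev norms of trigonometric polynomials grow polynomially -/

theorem haarAddCircle_eq_volume :
    (AddCircle.haarAddCircle : Measure UnitAddCircle) = volume := by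
  rw [AddCircle.volume_eq_smul_haarAddCircle]; simp

instance nullSingletonClass_haarAddCircle :
    NullSingletonClass (AddCircle.haarAddCircle : Measure UnitAddCircle) where
  measure_singleton a := by
    rw [haarAddCircle_eq_volume, ← (UnitAddCircle.measurePreserving_mk 0).measure_preimage
      (measurableSet_singleton a).nullMeasurableSet]
    obtain ⟨r, rfl⟩ := QuotientAddGroup.mk_surjective a
    refine (Set.Countable.mono (fun x hx => ?_) (countable_range fun n : ℤ => r + n)).measure_zero _
    have hx0 : ((x - r : ℝ) : UnitAddCircle) = 0 := by
      rw [AddCircle.coe_sub, sub_eq_zero]; exact hx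
    obtain ⟨n, hn⟩ := (AddCircle.coe_eq_zero_iff 1).1 hx0
    exact ⟨n, by simp at hn; simp [hn]⟩

/-- The norm on the circle is the distance to the nearest integer, hence `x` or `1 - x`; the sum
covers both cases. -/
theorem norm_coe_rpow_neg_le {α x : ℝ} (hx : x ∈ Ioc (0 : ℝ) 1) :
    ‖(x : UnitAddCircle)‖ ^ (-α) ≤ x ^ (-α) + (1 - x) ^ (-α) := by
  have h1 : 0 ≤ x ^ (-α) := Real.rpow_nonneg hx.1.le _
  have h2 : 0 ≤ (1 - x) ^ (-α) := Real.rpow_nonneg (by linarith [hx.2]) _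
  rcases le_total x (1 / 2) with h | h
  · rw [(AddCircle.norm_coe_eq_abs_iff 1 one_ne_zero).2 (by rw [abs_of_pos hx.1]; simpa using h),
      abs_of_pos hx.1]
    linarith
  · have he : (x : UnitAddCircle) = ((x - 1 : ℝ) : UnitAddCircle) := by
      rw [AddCircle.coe_sub, AddCircle.coe_period, sub_zero]
    have ha : |x - 1| = 1 - x := by rw [abs_sub_comm, abs_of_nonneg (by linarith [hx.2])]
    rw [he, (AddCircle.norm_coe_eq_abs_iff 1 one_ne_zero).2 (by rw [ha]; simp; linarith), ha]
    linarith

theorem integrable_norm_rpow_neg {α : ℝ} (h1 : α < 1) :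
    Integrable (fun z : UnitAddCircle => ‖z‖ ^ (-α)) AddCircle.haarAddCircle := by
  have hm : Measurable fun z : UnitAddCircle => ‖z‖ ^ (-α) := by fun_prop
  refine ⟨hm.aestronglyMeasurable, ?_⟩
  have hi : IntervalIntegrable (fun x : ℝ => x ^ (-α)) volume 0 1 :=
    intervalIntegral.intervalIntegrable_rpow' (by linarith)
  have hi2 : IntervalIntegrable (fun x : ℝ => (1 - x) ^ (-α)) volume 0 1 := by
    simpa using (hi.comp_sub_left 1).symm
  have hs := (hi.add hi2).1
  rw [haarAddCircle_eq_volume, HasFiniteIntegral,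
    ← UnitAddCircle.lintegral_preimage 0 fun z => ‖‖z‖ ^ (-α)‖ₑ, zero_add]
  refine lt_of_le_of_lt (setLIntegral_mono' measurableSet_Ioc fun x hx => ?_) hs.2
  refine enorm_le_iff_norm_le.2 ?_
  rw [Real.norm_of_nonneg (Real.rpow_nonneg (norm_nonneg _) _)]
  exact (norm_coe_rpow_neg_le hx).trans (le_abs_self _)

theorem norm_fourier_sub_le (n : ℤ) (x y : UnitAddCircle) :
    ‖(fourier n x : ℂ) - fourier n y‖ ≤ 7 * |(n : ℝ)| * dist x y := by
  have hone : ∀ z : UnitAddCircle, ‖(fourier n z : ℂ) - 1‖ ≤ 7 * |(n : ℝ)| * ‖z‖ := by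
    intro z
    obtain ⟨r, rfl⟩ := QuotientAddGroup.mk_surjective z
    have he : ((r - round r : ℝ) : UnitAddCircle) = (r : UnitAddCircle) := by
      rw [AddCircle.coe_sub, sub_eq_self]
      exact (AddCircle.coe_eq_zero_iff 1).2 ⟨round r, by simp⟩
    change ‖(fourier n (r : UnitAddCircle) : ℂ) - 1‖ ≤ 7 * |(n : ℝ)| * ‖(r : UnitAddCircle)‖
    rw [UnitAddCircle.norm_eq, ← he, fourier_coe_apply,
      show (2 * Real.pi * Complex.I * n * (r - round r : ℝ) / (1 : ℝ) : ℂ)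
        = Complex.I * ((2 * Real.pi * n * (r - round r) : ℝ) : ℂ) by push_cast; ring]
    refine Real.norm_exp_I_mul_ofReal_sub_one_le.trans ?_
    rw [Real.norm_eq_abs, abs_mul, abs_mul, abs_of_pos (by positivity : 0 < 2 * Real.pi)]
    gcongr
    -- The constant 7 is an upper bound for `2π`.
    linarith [Real.pi_lt_d2]
  have h : (fourier n x : ℂ) - fourier n y = fourier n y * (fourier n (x - y) - 1) := by
    have : (fourier n x : ℂ) = fourier n y * fourier n (x - y) := by
      simp only [fourier_apply, ← Circle.coe_mul, ← AddCircle.toCircle_add, ← smul_add]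
      simp
    rw [this]; ring
  rw [h, norm_mul, fourier_apply, Circle.norm_coe, one_mul, dist_eq_norm]
  exact hone _

/-- The weight `1 + |k₁| + |k₂| + |k₃|`. -/
def weight (k : Freq) : ℝ := 1 + ∑ i, |(k i : ℝ)|

theorem one_le_weight (k : Freq) : 1 ≤ weight k :=
  le_add_of_nonneg_right (Finset.sum_nonneg fun _ _ => abs_nonneg _)

theorem abs_le_weight (k : Freq) (i : Fin 3) : |(k i : ℝ)| ≤ weight k :=
  (Finset.single_le_sum (f := fun i => |(k i : ℝ)|) (fun _ _ => abs_nonneg _)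
    (Finset.mem_univ i)).trans (le_add_of_nonneg_left zero_le_one)

theorem weight_neg (k : Freq) : weight (-k) = weight k := by simp [weight]

theorem norm_mFourier_sub_le (k : Freq) (x y : T3) :
    ‖UnitAddTorus.mFourier k x - UnitAddTorus.mFourier k y‖ ≤ 7 * weight k * dist x y := by
  have h3 : ∀ a b c a' b' c' : ℂ, ‖a‖ = 1 → ‖b‖ = 1 → ‖b'‖ = 1 → ‖c'‖ = 1 →
      ‖a * b * c - a' * b' * c'‖ ≤ ‖a - a'‖ + ‖b - b'‖ + ‖c - c'‖ := by
    intro a b c a' b' c' ha hb hb' hc'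
    have : a * b * c - a' * b' * c' = (a - a') * b' * c' + a * (b - b') * c' + a * b * (c - c') := by
      ring
    rw [this]
    refine (norm_add₃_le).trans (le_of_eq ?_)
    simp [ha, hb, hb', hc']
  have hn : ∀ (n : ℤ) (z : UnitAddCircle), ‖(fourier n z : ℂ)‖ = 1 := fun n z => by
    rw [fourier_apply, Circle.norm_coe]
  simp only [UnitAddTorus.mFourier, ContinuousMap.coe_mk, Fin.prod_univ_three]
  refine (h3 _ _ _ _ _ _ (hn _ _) (hn _ _) (hn _ _) (hn _ _)).trans ?_
  have hd : ∀ i, ‖(fourier (k i) (x i) : ℂ) - fourier (k i) (y i)‖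
      ≤ 7 * |(k i : ℝ)| * dist x y := fun i =>
    (norm_fourier_sub_le _ _ _).trans
      (mul_le_mul_of_nonneg_left (dist_le_pi_dist x y i) (by positivity))
  have hw : weight k = 1 + (|(k 0 : ℝ)| + |(k 1 : ℝ)| + |(k 2 : ℝ)|) := by
    rw [weight, Fin.sum_univ_three]
  rw [hw]
  nlinarith [hd 0, hd 1, hd 2, dist_nonneg (x := x) (y := y)]

/-- `∑ |cᵢ| (1 + |κᵢ|)^s`. -/
def trigSize {ι : Type} [Fintype ι] (κ : ι → Freq) (c : ι → ℂ) (s : ℕ) : ℝ :=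
  ∑ i, ‖c i‖ * weight (κ i) ^ s

theorem trigSize_nonneg {ι : Type} [Fintype ι] (κ : ι → Freq) (c : ι → ℂ) (s : ℕ) :
    0 ≤ trigSize κ c s :=
  Finset.sum_nonneg fun _ _ =>
    mul_nonneg (norm_nonneg _) (pow_nonneg (zero_le_one.trans (one_le_weight _)) _)

theorem trigSize_mono {ι : Type} [Fintype ι] (κ : ι → Freq) (c : ι → ℂ) {s t : ℕ} (h : s ≤ t) :
    trigSize κ c s ≤ trigSize κ c t :=
  Finset.sum_le_sum fun _ _ =>
    mul_le_mul_of_nonneg_left (pow_le_pow_right₀ (one_le_weight _) h) (norm_nonneg _)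

theorem norm_trigPoly_le {ι : Type} [Fintype ι] (κ : ι → Freq) (c : ι → ℂ) (y : T3) :
    ‖trigPoly κ c y‖ ≤ trigSize κ c 0 := by
  refine (norm_sum_le _ _).trans (le_of_eq ?_)
  simp only [norm_mul, norm_mFourier_apply, trigSize, pow_zero]

theorem norm_trigPoly_sub_le {ι : Type} [Fintype ι] (κ : ι → Freq) (c : ι → ℂ) (x y : T3) :
    ‖trigPoly κ c x - trigPoly κ c y‖ ≤ 7 * trigSize κ c 1 * dist x y := by
  rw [trigPoly, trigPoly, ← Finset.sum_sub_distrib, trigSize, Finset.mul_sum, Finset.sum_mul]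
  refine norm_sum_le_of_le _ fun i _ => ?_
  rw [← mul_sub, norm_mul, pow_one]
  calc _ ≤ ‖c i‖ * (7 * weight (κ i) * dist x y) :=
        mul_le_mul_of_nonneg_left (norm_mFourier_sub_le _ _ _) (norm_nonneg _)
    _ = _ := by ring

theorem dist_le_one (x y : T3) : dist x y ≤ 1 := by
  refine (dist_pi_le_iff zero_le_one).2 fun i => ?_
  rw [dist_eq_norm]
  refine (AddCircle.norm_le_half_period 1 one_ne_zero).trans ?_
  norm_num

/-- Distances are at most one, so the exponent may be lowered to `-γ`. The sup metric dominates
every coordinate difference, so `dist ^ (-γ)` splits into three one-dimensional singularities of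
order `γ / 3`. -/
theorem edist_kernel_le {σ P γ : ℝ} (hγ : 0 ≤ γ) (hγP : 3 + σ * P - P ≤ γ) {x y : T3}
    (h : ∀ i, y i ≠ x i) :
    edist x y ^ P / edist x y ^ (3 + σ * P)
      ≤ ENNReal.ofReal (∏ i, ‖x i - y i‖ ^ (-(γ / 3))) := by
  have hn : ∀ i, 0 < ‖x i - y i‖ := fun i => norm_pos_iff.2 (sub_ne_zero.2 (h i).symm)
  have hd : ∀ i, ‖x i - y i‖ ≤ dist x y := fun i => by
    rw [← dist_eq_norm]; exact dist_le_pi_dist x y i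
  have hd0 : 0 < dist x y := (hn 0).trans_le (hd 0)
  rw [edist_dist, ENNReal.ofReal_rpow_of_pos hd0, ENNReal.ofReal_rpow_of_pos hd0,
    ← ENNReal.ofReal_div_of_pos (Real.rpow_pos_of_pos hd0 _), ← Real.rpow_sub hd0]
  refine ENNReal.ofReal_le_ofReal ?_
  calc dist x y ^ (P - (3 + σ * P)) ≤ dist x y ^ (-γ) :=
        Real.rpow_le_rpow_of_exponent_ge hd0 (dist_le_one x y) (by linarith)
    _ = ∏ _i : Fin 3, dist x y ^ (-(γ / 3)) := by
        rw [Finset.prod_const, Finset.card_univ, Fintype.card_fin, ← Real.rpow_mul_natCast hd0.le]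
        congr 1; push_cast; ring
    _ ≤ ∏ i, ‖x i - y i‖ ^ (-(γ / 3)) :=
        Finset.prod_le_prod (fun _ _ => (Real.rpow_pos_of_pos hd0 _).le) fun i _ =>
          Real.rpow_le_rpow_of_nonpos (hn i) (hd i) (by linarith)

/-- As `σ < 1`, the singularity has order `γ < 3`, so each one-dimensional factor has order `γ / 3 <
1` and is integrable. Translation invariance makes the bound independent of `x`. -/
theorem exists_lintegral_edist_kernel_le {σ P : ℝ} (hσ : σ < 1) (hP : 0 < P) :
    ∃ J : ℝ≥0, ∀ x : T3, ∫⁻ y, edist x y ^ P / edist x y ^ (3 + σ * P) ∂haar3 ≤ J := by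
  set γ := max (3 + σ * P - P) 0
  have hγ : γ < 3 := max_lt (by nlinarith) (by norm_num)
  have hγ0 : 0 ≤ γ := le_max_right _ _
  have hi := integrable_norm_rpow_neg (α := γ / 3) (by linarith)
  refine ⟨Real.toNNReal (∏ _i : Fin 3,
    ∫ z : UnitAddCircle, ‖z‖ ^ (-(γ / 3)) ∂AddCircle.haarAddCircle), fun x => ?_⟩
  have hprod : Integrable (fun y : T3 => ∏ i, ‖x i - y i‖ ^ (-(γ / 3))) haar3 :=
    Integrable.fintype_prod (f := fun i (t : UnitAddCircle) => ‖x i - t‖ ^ (-(γ / 3)))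
      fun i => hi.comp_sub_left (x i)
  have hint : ∫ y : T3, ∏ i, ‖x i - y i‖ ^ (-(γ / 3)) ∂haar3 = ∏ _i : Fin 3,
      ∫ z : UnitAddCircle, ‖z‖ ^ (-(γ / 3)) ∂AddCircle.haarAddCircle := by
    rw [integral_fintype_prod_eq_prod (fun i (t : UnitAddCircle) => ‖x i - t‖ ^ (-(γ / 3)))]
    exact Finset.prod_congr rfl fun i _ =>
      integral_sub_left_eq_self (fun z : UnitAddCircle => ‖z‖ ^ (-(γ / 3))) _ (x i)
  change _ ≤ ENNReal.ofReal _
  rw [← hint, ofReal_integral_eq_lintegral_ofReal hprod (Filter.Eventually.of_forall fun y =>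
    Finset.prod_nonneg fun i _ => Real.rpow_nonneg (norm_nonneg _) _)]
  refine lintegral_mono_ae ?_
  have hne : ∀ᵐ y ∂haar3, ∀ i, y i ≠ x i := ae_all_iff.2 fun i => 
    Measure.ae_eval_ne (fun _ : Fin 3 => (AddCircle.haarAddCircle : Measure UnitAddCircle)) i (x i)
  filter_upwards [hne] with y hy
  exact edist_kernel_le hγ0 (le_max_left _ _) hy

/-- The Lipschitz constant `7 * trigSize κ c 1` comes out of the kernel integral, and the outer
integral runs over a probability space. -/
theorem exists_gagliardo_trigPoly_le {σ : ℝ} (hσ : σ < 1) {p : ℝ≥0∞} (hp : 1 ≤ p) (hp' : p < ∞) :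
    ∃ J : ℝ≥0, ∀ (ι : Type) [Fintype ι] (κ : ι → Freq) (c : ι → ℂ),
      gagliardo σ p (trigPoly κ c) ≤ J * ENNReal.ofReal (trigSize κ c 1) := by
  have hP : 0 < p.toReal := ENNReal.toReal_pos (one_pos.trans_le hp).ne' hp'.ne
  obtain ⟨J, hJ⟩ := exists_lintegral_edist_kernel_le hσ hP
  refine ⟨7 * J ^ (1 / p.toReal), fun ι _ κ c => ?_⟩
  set L := ENNReal.ofReal (7 * trigSize κ c 1)
  have hL : ∀ x y, ‖trigPoly κ c x - trigPoly κ c y‖ₑ ≤ L * edist x y := fun x y => by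
    rw [edist_dist, ← ENNReal.ofReal_mul (mul_nonneg (by norm_num) (trigSize_nonneg _ _ _)),
      ← ofReal_norm]
    exact ENNReal.ofReal_le_ofReal (norm_trigPoly_sub_le κ c x y)
  have hLtop : L ^ p.toReal ≠ ∞ := ENNReal.rpow_ne_top_of_nonneg hP.le ENNReal.ofReal_ne_top
  have hin : ∀ x, ∫⁻ y, ‖trigPoly κ c x - trigPoly κ c y‖ₑ ^ p.toReal
      / edist x y ^ (3 + σ * p.toReal) ∂haar3 ≤ L ^ p.toReal * J := fun x => by
    refine le_trans (lintegral_mono fun y => ?_) ((lintegral_const_mul' _ _ hLtop).trans_le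
      (mul_le_mul_right (hJ x) _))
    rw [← mul_div_assoc, ← ENNReal.mul_rpow_of_nonneg _ _ hP.le]
    exact ENNReal.div_le_div_right (ENNReal.rpow_le_rpow (hL x y) hP.le) _
  unfold gagliardo
  calc _ ≤ (L ^ p.toReal * J) ^ (1 / p.toReal) := by
        refine ENNReal.rpow_le_rpow ((lintegral_mono hin).trans ?_) (by positivity)
        simp
    _ = L * (J ^ (1 / p.toReal) : ℝ≥0) := by
        rw [ENNReal.mul_rpow_of_nonneg _ _ (by positivity), ← ENNReal.rpow_mul,
          mul_one_div_cancel hP.ne', ENNReal.rpow_one, ENNReal.coe_rpow_of_nonneg _ (by positivity)]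
    _ = _ := by
        rw [show L = 7 * ENNReal.ofReal (trigSize κ c 1) by
          rw [← ENNReal.ofReal_ofNat 7, ← ENNReal.ofReal_mul (by norm_num)]]
        push_cast; ring

theorem lpENorm_trigPoly_le (p : ℝ≥0∞) {ι : Type} [Fintype ι] (κ : ι → Freq) (c : ι → ℂ) :
    lpENorm p (trigPoly κ c) ≤ ENNReal.ofReal (trigSize κ c 0) := by
  refine (eLpNorm_le_of_ae_bound (Filter.Eventually.of_forall (norm_trigPoly_le κ c))).trans ?_
  simp

/-- The multiplier `m` applied to the real part of a trigonometric polynomial, which is itself a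
trigonometric polynomial with the frequencies `±κ`. -/
theorem isMultiplier_reTrig (m : Freq → ℂ) {ι : Type} [Fintype ι] (κ : ι → Freq) (c : ι → ℂ) :
    IsMultiplier m (reTrig κ c) (trigPoly (Sum.elim κ fun i => -κ i)
      (Sum.elim (fun i => m (κ i) * (c i / 2)) fun i => m (-κ i) * (star (c i) / 2))) := by
  refine ⟨(continuous_reTrig κ c).integrable_of_hasCompactSupport
    (HasCompactSupport.of_compactSpace _), integrable_of_continuous (continuous_trigPoly _ _),
    fun k => ?_⟩
  rw [coeff_trigPoly, rcoeff_reTrig, Fintype.sum_sum_type, ← Finset.sum_add_distrib,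
    Finset.mul_sum]
  refine Finset.sum_congr rfl fun i _ => ?_
  have h : ∀ (l : Freq) (a : ℂ), (m l * a * if k = l then 1 else 0)
      = m k * (a * if k = l then 1 else 0) := fun l a => by
    split_ifs with h
    · rw [h]; ring
    · simp
  rw [mul_add, ← h, ← h]
  rfl

theorem trigSize_multiplier_le {m : Freq → ℂ} {r : ℕ} (hm : ∀ k, ‖m k‖ ≤ weight k ^ r)
    {ι : Type} [Fintype ι] (κ : ι → Freq) (c : ι → ℂ) (s : ℕ) :
    trigSize (Sum.elim κ fun i => -κ i) (Sum.elim (fun i => m (κ i) * (c i / 2))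
      fun i => m (-κ i) * (star (c i) / 2)) s ≤ trigSize κ c (r + s) := by
  rw [trigSize, trigSize, Fintype.sum_sum_type, ← Finset.sum_add_distrib]
  refine Finset.sum_le_sum fun i _ => ?_
  simp only [Sum.elim_inl, Sum.elim_inr, norm_mul, norm_div, norm_star, weight_neg]
  have h1 := hm (κ i)
  have h2 := hm (-κ i)
  rw [weight_neg] at h2
  have hw : 0 ≤ weight (κ i) ^ s := pow_nonneg (zero_le_one.trans (one_le_weight _)) _
  rw [pow_add]
  norm_num
  have h3 : 0 ≤ ‖c i‖ * weight (κ i) ^ s := mul_nonneg (norm_nonneg _) hw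
  nlinarith [mul_le_mul_of_nonneg_right h1 h3, mul_le_mul_of_nonneg_right h2 h3]

/-- `Φ` is bounded polynomially in the frequencies on real trigonometric polynomials. -/
def TrigBounded (Φ : (T3 → ℝ) → ℝ≥0∞) : Prop :=
  ∃ (C : ℝ≥0) (s : ℕ), ∀ (ι : Type) [Fintype ι] (κ : ι → Freq) (c : ι → ℂ),
    Φ (reTrig κ c) ≤ C * ENNReal.ofReal (trigSize κ c s)

theorem TrigBounded.add {Φ Ψ : (T3 → ℝ) → ℝ≥0∞} (hΦ : TrigBounded Φ) (hΨ : TrigBounded Ψ) :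
    TrigBounded fun f => Φ f + Ψ f := by
  obtain ⟨C, s, hC⟩ := hΦ
  obtain ⟨D, t, hD⟩ := hΨ
  refine ⟨C + D, max s t, fun ι _ κ c => ?_⟩
  rw [ENNReal.coe_add, add_mul]
  refine add_le_add ((hC ι κ c).trans ?_) ((hD ι κ c).trans ?_)
  · gcongr; exact trigSize_mono _ _ (le_max_left _ _)
  · gcongr; exact trigSize_mono _ _ (le_max_right _ _)

theorem TrigBounded.sum {A : Type*} (S : Finset A) {Φ : A → (T3 → ℝ) → ℝ≥0∞}
    (h : ∀ a ∈ S, TrigBounded (Φ a)) : TrigBounded fun f => ∑ a ∈ S, Φ a f := by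
  classical
  induction S using Finset.induction_on with
  | empty => exact ⟨0, 0, fun ι _ κ c => by simp⟩
  | insert a S ha ih =>
    simp only [Finset.sum_insert ha]
    exact (h a (Finset.mem_insert_self _ _)).add
      (ih fun b hb => h b (Finset.mem_insert_of_mem hb))

theorem trigBounded_multEval {Q : (T3 → ℂ) → ℝ≥0∞} {m : Freq → ℂ} {J : ℝ≥0} {s r : ℕ}
    (hQ : ∀ (ι : Type) [Fintype ι] (κ : ι → Freq) (c : ι → ℂ),
      Q (trigPoly κ c) ≤ J * ENNReal.ofReal (trigSize κ c s))
    (hm : ∀ k, ‖m k‖ ≤ weight k ^ r) : TrigBounded (multEval Q m) := by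
  refine ⟨J, r + s, fun ι _ κ c => (iInf₂_le _ (isMultiplier_reTrig m κ c)).trans ?_⟩
  refine (hQ _ _ _).trans ?_
  gcongr
  exact trigSize_multiplier_le hm κ c s

theorem norm_derivSymbol_le (α : Fin 3 → ℕ) (k : Freq) :
    ‖derivSymbol α k‖ ≤ weight k ^ ∑ i, α i := by
  rw [derivSymbol, norm_prod, ← Finset.prod_pow_eq_pow_sum]
  refine Finset.prod_le_prod (fun _ _ => norm_nonneg _) fun i _ => ?_
  rw [norm_pow]
  refine pow_le_pow_left₀ (norm_nonneg _) ?_ _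
  simpa using abs_le_weight k i

theorem norm_besselSymbol_le (s : ℝ) (k : Freq) :
    ‖besselSymbol s k‖ ≤ weight k ^ ⌈|s|⌉₊ := by
  have hn : 0 ≤ normSq k := Finset.sum_nonneg fun _ _ => sq_nonneg _
  have hw := one_le_weight k
  have hle : 1 + normSq k ≤ weight k ^ 2 := by
    simp only [normSq, weight, Fin.sum_univ_three]
    simp only [← sq_abs ((k _ : ℤ) : ℝ)]
    nlinarith [abs_nonneg (k 0 : ℝ), abs_nonneg (k 1 : ℝ), abs_nonneg (k 2 : ℝ),
      mul_nonneg (abs_nonneg (k 0 : ℝ)) (abs_nonneg (k 1 : ℝ)),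
      mul_nonneg (abs_nonneg (k 0 : ℝ)) (abs_nonneg (k 2 : ℝ)),
      mul_nonneg (abs_nonneg (k 1 : ℝ)) (abs_nonneg (k 2 : ℝ))]
  rw [besselSymbol, Complex.norm_real, Real.norm_of_nonneg (Real.rpow_nonneg (by linarith) _)]
  calc (1 + normSq k) ^ (s / 2) ≤ (1 + normSq k) ^ (|s| / 2) :=
        Real.rpow_le_rpow_of_exponent_le (by linarith) (by linarith [le_abs_self s])
    _ ≤ (weight k ^ 2) ^ (|s| / 2) := Real.rpow_le_rpow (by linarith) hle (by positivity)
    _ = weight k ^ |s| := by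
        rw [← Real.rpow_natCast_mul (by linarith)]
        congr 1; push_cast; ring
    _ ≤ weight k ^ (⌈|s|⌉₊ : ℝ) := Real.rpow_le_rpow_of_exponent_le hw (Nat.le_ceil _)
    _ = weight k ^ ⌈|s|⌉₊ := Real.rpow_natCast _ _

theorem trigBounded_intSobolevNorm (n : ℕ) (p : ℝ≥0∞) : TrigBounded (intSobolevNorm n p) :=
  TrigBounded.sum _ fun _ _ => TrigBounded.sum _ fun α _ =>
    trigBounded_multEval (J := 1) (fun _ _ κ c => by simpa using lpENorm_trigPoly_le p κ c)
      (norm_derivSymbol_le α)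

theorem trigBounded_eNorm (Y : SobolevSpace) : TrigBounded Y.eNorm := by
  cases Y with
  | integer n p hp => exact trigBounded_intSobolevNorm n p
  | bessel s p hp hp' =>
    exact trigBounded_multEval (J := 1) (fun _ _ κ c => by simpa using lpENorm_trigPoly_le p κ c)
      (norm_besselSymbol_le s)
  | slobodeckij n σ hσ hσ' p hp hp' =>
    obtain ⟨J, hJ⟩ := exists_gagliardo_trigPoly_le hσ' hp hp'
    exact (trigBounded_intSobolevNorm n p).add (TrigBounded.sum _ fun α _ =>
      trigBounded_multEval (fun ι _ κ c => hJ ι κ c) (norm_derivSymbol_le α))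

/-! ### The linearised system and Duhamel's formula -/

/-- The iterates of the linearised operator `(L b)ₙ = μₙ₋₂ bₙ₋₂ + μₙ₊₂ bₙ₊₂`. -/
def iter (μ : ℤ → ℝ) (b : ℤ → ℝ) : ℕ → ℤ → ℝ
  | 0, n => b n
  | j + 1, n => μ (n - 2) * iter μ b j (n - 2) + μ (n + 2) * iter μ b j (n + 2)

theorem iter_nonneg {μ b : ℤ → ℝ} (hμ : ∀ n, 0 ≤ μ n) (hb : ∀ n, 0 ≤ b n) :
    ∀ j n, 0 ≤ iter μ b j n
  | 0, _ => hb _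
  | j + 1, _ => add_nonneg (mul_nonneg (hμ _) (iter_nonneg hμ hb j _))
      (mul_nonneg (hμ _) (iter_nonneg hμ hb j _))

/-- Only the walk `1 → -1 → 1 → ⋯` is kept; all other contributions are nonnegative. -/
theorem pow_le_iter {μ b : ℤ → ℝ} (hμ : ∀ n, 0 ≤ μ n) (hb : ∀ n, 0 ≤ b n) (hb1 : 1 ≤ b 1)
    {c : ℝ} (hc : 0 ≤ c) (h1 : c ≤ μ 1) (h2 : c ≤ μ (-1)) (i : ℕ) :
    c ^ (2 * i) ≤ iter μ b (2 * i) 1 := by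
  have hnn := iter_nonneg hμ hb
  induction i with
  | zero => simpa [iter] using hb1
  | succ i ih =>
    have e1 : c ^ (2 * i + 1) ≤ iter μ b (2 * i + 1) (-1) := by
      rw [iter, pow_succ']
      exact (mul_le_mul h1 ih (by positivity) (hμ _)).trans
        (le_add_of_nonneg_left (mul_nonneg (hμ _) (hnn _ _)))
    rw [show 2 * (i + 1) = 2 * i + 1 + 1 by ring, iter, pow_succ']
    exact (mul_le_mul h2 e1 (by positivity) (hμ _)).trans
      (le_add_of_nonneg_right (mul_nonneg (hμ _) (hnn _ _)))

/-- The constants of the error term of the iterated Duhamel formula. -/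
def errConst (T m : ℝ) : ℕ → ℝ
  | 0 => 0
  | J + 1 => T * (2 * m * errConst T m J + 1)

theorem errConst_nonneg {T m : ℝ} (hT : 0 ≤ T) (hm : 0 ≤ m) : ∀ J, 0 ≤ errConst T m J
  | 0 => le_rfl
  | J + 1 => by
    have := errConst_nonneg hT hm J
    rw [errConst]; positivity

theorem ae_Ioc_of_ae_Ioo {T t : ℝ} (ht : t ∈ Ioo 0 T) {p : ℝ → Prop}
    (h : ∀ᵐ s ∂volume.restrict (Ioo 0 T), p s) : ∀ᵐ s, s ∈ Ioc 0 t → p s := by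
  filter_upwards [(ae_restrict_iff' measurableSet_Ioo).1 h] with s hs hst
  exact hs ⟨hst.1, hst.2.trans_lt ht.2⟩

theorem integral_pow_div_factorial (J : ℕ) (t : ℝ) :
    ∫ s in (0 : ℝ)..t, s ^ J / J.factorial = t ^ (J + 1) / (J + 1).factorial := by
  rw [intervalIntegral.integral_div, integral_pow, Nat.factorial_succ]
  have : (J.factorial : ℝ) ≠ 0 := by positivity
  have : (J + 1 : ℝ) ≠ 0 := by positivity
  push_cast
  field_simp
  simp

/-- Iterated Duhamel formula for an approximate solution of the infinite linear system
`aₙ' = μₙ₋₂ aₙ₋₂ + μₙ₊₂ aₙ₊₂`. -/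
theorem norm_sub_taylor_le {T m S δ ε : ℝ} {μ b : ℤ → ℝ} {a G : ℤ → ℝ → ℂ} (hm : 0 ≤ m)
    (hμ : ∀ n, |μ n| ≤ m) (hδ : 0 ≤ δ) (hint : ∀ n, IntegrableOn (G n) (Ioo 0 T))
    (heq : ∀ n, ∀ᵐ t ∂volume.restrict (Ioo 0 T), a n t = ε * b n + ∫ s in (0 : ℝ)..t, G n s)
    (hG : ∀ n, ∀ᵐ s ∂volume.restrict (Ioo 0 T),
      ‖G n s - (μ (n - 2) * a (n - 2) s + μ (n + 2) * a (n + 2) s)‖ ≤ δ)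
    (hS : ∀ n, ∀ᵐ s ∂volume.restrict (Ioo 0 T), ‖a n s‖ ≤ S) (J : ℕ) (n : ℤ) :
    ∀ᵐ t ∂volume.restrict (Ioo 0 T),
      ‖a n t - ∑ j ∈ Finset.range J, ((t ^ j / j.factorial * (ε * iter μ b j n) : ℝ) : ℂ)‖
        ≤ S * (2 * m) ^ J * (t ^ J / J.factorial) + δ * errConst T m J := by
  induction J generalizing n with
  | zero => filter_upwards [hS n] with t ht; simpa [errConst] using ht
  | succ J ih =>
    filter_upwards [heq n, ae_restrict_mem measurableSet_Ioo] with t hta ht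
    have ht0 := ht.1.le
    have hGi : IntervalIntegrable (G n) volume 0 t :=
      (intervalIntegrable_iff_integrableOn_Ioc_of_le ht0).2
        ((hint n).mono_set fun s hs => ⟨hs.1, hs.2.trans_lt ht.2⟩)
    -- `q` is the time derivative of the Taylor polynomial with `J + 1` terms. Its integral restores
    -- all terms but `j = 0`, which is the initial value `ε * b n`.
    set q : ℝ → ℂ := fun s =>
      ∑ j ∈ Finset.range J, ((s ^ j / j.factorial * (ε * iter μ b (j + 1) n) : ℝ) : ℂ)
    have hq : IntervalIntegrable q volume 0 t := by
      apply Continuous.intervalIntegrable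
      fun_prop
    have hqint : ∫ s in (0 : ℝ)..t, q s = ∑ j ∈ Finset.range J,
        ((t ^ (j + 1) / (j + 1).factorial * (ε * iter μ b (j + 1) n) : ℝ) : ℂ) := by
      rw [intervalIntegral.integral_finsetSum fun j _ =>
        Continuous.intervalIntegrable (by fun_prop) _ _]
      refine Finset.sum_congr rfl fun j _ => ?_
      rw [intervalIntegral.integral_ofReal, intervalIntegral.integral_mul_const,
        integral_pow_div_factorial]
    have hsplit : a n t - ∑ j ∈ Finset.range (J + 1),
        ((t ^ j / j.factorial * (ε * iter μ b j n) : ℝ) : ℂ) = ∫ s in (0 : ℝ)..t, (G n s - q s) := by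
      rw [intervalIntegral.integral_sub hGi hq, hqint, Finset.sum_range_succ', hta]
      simp [iter]
      ring
    have hbd : ∀ᵐ s, s ∈ Ioc 0 t → ‖G n s - q s‖ ≤
        S * (2 * m) ^ (J + 1) * (s ^ J / J.factorial) + δ * (2 * m * errConst T m J + 1) := by
      filter_upwards [ae_Ioc_of_ae_Ioo ht (hG n), ae_Ioc_of_ae_Ioo ht (ih (n - 2)),
        ae_Ioc_of_ae_Ioo ht (ih (n + 2))] with s h1 h2 h3 hs
      replace h1 := h1 hs
      replace h2 := h2 hs
      replace h3 := h3 hs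
      set p : ℤ → ℂ := fun l =>
        ∑ j ∈ Finset.range J, ((s ^ j / j.factorial * (ε * iter μ b j l) : ℝ) : ℂ)
      -- By the recursion for `iter`, `q` is the linear operator applied to the Taylor polynomials
      -- at `n ± 2`. So the induction hypothesis enters at two neighbours, each with a factor `m`:
      -- this is the source of `2 * m`.
      have hqp : q s = μ (n - 2) * p (n - 2) + μ (n + 2) * p (n + 2) := by
        simp only [q, p, Finset.mul_sum, ← Finset.sum_add_distrib]
        refine Finset.sum_congr rfl fun j _ => ?_
        rw [iter]; push_cast; ring
      have hdec : G n s - q s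
          = (G n s - (μ (n - 2) * a (n - 2) s + μ (n + 2) * a (n + 2) s))
            + μ (n - 2) * (a (n - 2) s - p (n - 2)) + μ (n + 2) * (a (n + 2) s - p (n + 2)) := by
        rw [hqp]; ring
      have hmul : ∀ l, ‖a l s - p l‖ ≤ S * (2 * m) ^ J * (s ^ J / J.factorial) + δ * errConst T m J →
          ‖(μ l : ℂ) * (a l s - p l)‖
            ≤ m * (S * (2 * m) ^ J * (s ^ J / J.factorial) + δ * errConst T m J) := fun l hl => by
        rw [norm_mul, Complex.norm_real]
        exact mul_le_mul (hμ l) hl (norm_nonneg _) hm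
      rw [hdec]
      refine (norm_add₃_le).trans ?_
      have h4 := hmul _ h2
      have h5 := hmul _ h3
      rw [pow_succ]
      linarith
    have hgi : IntervalIntegrable (fun s : ℝ => S * (2 * m) ^ (J + 1) * (s ^ J / J.factorial)
        + δ * (2 * m * errConst T m J + 1)) volume 0 t :=
      Continuous.intervalIntegrable (by fun_prop) _ _
    rw [hsplit]
    refine (intervalIntegral.norm_integral_le_of_norm_le ht0 hbd hgi).trans ?_
    rw [intervalIntegral.integral_add (Continuous.intervalIntegrable (by fun_prop) _ _)
      (Continuous.intervalIntegrable (by fun_prop) _ _), intervalIntegral.integral_const_mul,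
      integral_pow_div_factorial, intervalIntegral.integral_const, smul_eq_mul, sub_zero, errConst]
    have hc := errConst_nonneg (ht.1.le.trans ht.2.le) hm J
    have : t * (δ * (2 * m * errConst T m J + 1)) ≤ T * (δ * (2 * m * errConst T m J + 1)) :=
      mul_le_mul_of_nonneg_right ht.2.le (by positivity)
    linarith

/-! ### The symbol `M̂₃` on the line `(K², K, n)` -/

/-- The frequency `(K², K, n)`. -/
def line (K : ℕ) (n : ℤ) : Freq := ![(K : ℤ) ^ 2, K, n]

theorem line_sub (K : ℕ) (n : ℤ) : line K n - vert = line K (n - 2) := by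
  ext i; fin_cases i <;> simp [line, vert]

theorem line_add (K : ℕ) (n : ℤ) : line K n + vert = line K (n + 2) := by
  ext i; fin_cases i <;> simp [line, vert]

/-- The line avoids the frequencies of the steady state, so on it the solution and its perturbation
have the same coefficients. -/
theorem steadyCoeff_line {K : ℕ} (hK : 0 < K) (n : ℤ) : steadyCoeff (line K n) = 0 := by
  refine steadyCoeff_eq_zero (fun h => ?_) fun h => ?_ <;>
  · have := congrFun h 1
    simp [line, vert] at this
    omega

/-- Fourier coefficients of `2 cos (k·x)`, `k = (K², K, 1)`, at the frequencies `(K², K, n)`. -/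
def startCoeff (n : ℤ) : ℝ := if n = 1 then 1 else 0

theorem cosCoeff_line {K : ℕ} (hK : 0 < K) (n : ℤ) :
    cosCoeff (line K 1) (line K n) = (startCoeff n : ℂ) := by
  have h1 : line K n = line K 1 ↔ n = 1 :=
    ⟨fun h => by simpa [line] using congrFun h 2, fun h => by rw [h]⟩
  have h2 : line K n ≠ -line K 1 := fun h => by
    have := congrFun h 1
    simp [line] at this
    omega
  simp only [cosCoeff, startCoeff, h1, h2, if_false, add_zero]
  split_ifs <;> simp

theorem symbolM_two_line (N : ℝ) (K : ℕ) {n : ℤ} (hn : n ≠ 0) : symbolM N 2 (line K n) =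
    N ^ 2 * K ^ 2 * (K ^ 4 + K ^ 2) /
      (N ^ 4 * ((K ^ 4 + K ^ 2 + (n : ℝ) ^ 2) * (n : ℝ) ^ 2) + K ^ 4) := by
  rw [symbolM, if_neg (show line K n 2 ≠ 0 from hn)]
  congr 1
  · simp [line]; ring
  · simp [symbolD, normSq_eq, line]; ring

/-- For `n ≠ 0` the first term of the denominator alone is at least `N⁴ (K⁴ + K²)`, which cancels
against the numerator. -/
theorem symbolM_two_line_bounds {N : ℝ} (hN : 0 < N) {K : ℕ} (hK : 0 < K) (n : ℤ) :
    0 ≤ symbolM N 2 (line K n) ∧ symbolM N 2 (line K n) ≤ K ^ 2 / N ^ 2 := by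
  have hK0 : (0 : ℝ) < K := by exact_mod_cast hK
  by_cases h : n = 0
  · rw [symbolM, if_pos (show line K n 2 = 0 from h)]
    exact ⟨le_rfl, by positivity⟩
  have hn : (1 : ℝ) ≤ (n : ℝ) ^ 2 := one_le_sq_of_ne_zero h
  rw [symbolM_two_line N K h]
  refine ⟨by positivity, ?_⟩
  rw [div_le_div_iff₀ (by positivity) (by positivity)]
  have h1 : (K : ℝ) ^ 4 + K ^ 2 ≤ (K ^ 4 + K ^ 2 + (n : ℝ) ^ 2) * (n : ℝ) ^ 2 := by
    have : (0 : ℝ) ≤ K ^ 4 + K ^ 2 := by positivity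
    nlinarith
  have h2 : (0 : ℝ) ≤ K ^ 2 * K ^ 4 := by positivity
  have h3 := mul_le_mul_of_nonneg_left h1 (by positivity : (0 : ℝ) ≤ N ^ 4 * K ^ 2)
  nlinarith

/-- This is where the choice `k₁ = k₂²` matters: at `n = ±1` the denominator is at most `(3 N⁴ + 1)
(K⁴ + K²)`, so a full factor `K²` remains. -/
theorem le_symbolM_two_line {N : ℝ} (hN : 0 < N) {K : ℕ} (hK : 0 < K) {n : ℤ}
    (hn : (n : ℝ) ^ 2 = 1) : N ^ 2 / (3 * N ^ 4 + 1) * K ^ 2 ≤ symbolM N 2 (line K n) := by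
  have hK1 : (1 : ℝ) ≤ K := by exact_mod_cast hK
  have hn0 : n ≠ 0 := by rintro rfl; simp at hn
  rw [symbolM_two_line N K hn0, hn, mul_one, div_mul_eq_mul_div,
    div_le_div_iff₀ (by positivity) (by positivity)]
  have h2 : (1 : ℝ) ≤ K ^ 2 := one_le_pow₀ hK1
  have h3 : (K : ℝ) ^ 4 = K ^ 2 * K ^ 2 := by ring
  have h4 : N ^ 4 * (K ^ 4 + K ^ 2 + 1) + (K : ℝ) ^ 4 ≤ (K ^ 4 + K ^ 2) * (3 * N ^ 4 + 1) := by
    have : 0 < N ^ 4 := by positivity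
    nlinarith [mul_nonneg this.le (by linarith : (0 : ℝ) ≤ K ^ 2 - 1),
      mul_nonneg this.le (by nlinarith : (0 : ℝ) ≤ K ^ 4 - 1)]
  have h5 := mul_le_mul_of_nonneg_left h4 (by positivity : (0 : ℝ) ≤ N ^ 2 * K ^ 2)
  linarith

/-! ### Lipschitz well-posedness bounds the linearised flow -/

/-- Taylor polynomials of the linearised flow are controlled by a Lipschitz bound for the
difference of a solution and the steady state. -/
theorem sum_iter_le_of_isSolution {N : ℝ} (hN : 0 < N) {X : SobolevSpace} {T T₀ ε B : ℝ} {K : ℕ}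
    (hK : 0 < K) (hT₀ : 0 < T₀) (hT : T₀ ≤ T) (hε : 0 < ε) (hB : 0 ≤ B) {θ w : ℝ → T3 → ℝ}
    (hθ : IsSolution N X T (datum (line K 1) ε) θ)
    (hw : ∀ᵐ t ∂volume.restrict (Ioo 0 T₀), W14.eNorm (w t) ≤ ENNReal.ofReal (ε * B) ∧
      ∀ l, rcoeff (θ t) l = steadyCoeff l + rcoeff (w t) l) (J : ℕ) :
    ∑ j ∈ Finset.range J, (T₀ / 2) ^ j / j.factorial *
      iter (fun n => symbolM N 2 (line K n)) startCoeff j 1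
        ≤ B + B * (2 * (K ^ 2 / N ^ 2)) ^ J * (T₀ ^ J / J.factorial)
          + ε * (12 * B ^ 2 * errConst T₀ (K ^ 2 / N ^ 2) J) := by
  set m : ℝ := K ^ 2 / N ^ 2
  set μ : ℤ → ℝ := fun n => symbolM N 2 (line K n)
  have hsub : Ioo 0 T₀ ⊆ Ioo 0 T := Ioo_subset_Ioo_right hT
  have hm : 0 ≤ m := by positivity
  have hμ0 : ∀ n, 0 ≤ μ n := fun n => (symbolM_two_line_bounds hN hK n).1
  have hεB : 0 ≤ ε * B := by positivity
  have hS : ∀ n, ∀ᵐ s ∂volume.restrict (Ioo 0 T₀), ‖rcoeff (θ s) (line K n)‖ ≤ ε * B := fun n => by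
    filter_upwards [hw] with s hs
    rw [hs.2, steadyCoeff_line hK, zero_add]
    exact norm_rcoeff_le_of_W14 hεB hs.1 _
  have htaylor := norm_sub_taylor_le (T := T₀) (S := ε * B) (δ := 12 * (ε * B) ^ 2) (ε := ε)
    (μ := μ) (b := startCoeff) (a := fun n t => rcoeff (θ t) (line K n))
    (G := fun n s => -coeff (advection N (θ s)) (line K n)) hm
    (fun n => by
      rw [abs_of_nonneg (hμ0 n)]; exact (symbolM_two_line_bounds hN hK n).2)
    (by positivity) (fun n => ((hθ.integrable _).mono_set hsub).neg)
    (fun n => by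
      filter_upwards [ae_restrict_of_ae_restrict_of_subset hsub (hθ.equation (line K n))] with t ht
      rw [ht, rcoeff_datum, steadyCoeff_line hK, cosCoeff_line hK, zero_add,
        intervalIntegral.integral_neg, sub_eq_add_neg])
    (fun n => by
      filter_upwards [hw] with s hs
      have h := norm_coeff_advection_add_le hN hεB (rcoeff_datum_zero (line K 1))
        (fun l => by rw [hs.2 l, rcoeff_datum_zero]) hs.1 (line K n)
      rw [line_sub, line_add] at h
      have h2 : ∀ l, rcoeff (θ s) (line K l) = rcoeff (w s) (line K l) := fun l => by
        rw [hs.2, steadyCoeff_line hK, zero_add]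
      rw [← h2, ← h2, ← norm_neg] at h
      refine le_trans (le_of_eq (congrArg _ ?_)) h
      ring)
    hS J 1
  -- The estimates hold for a.e. `t` only, so `t` is picked from a set of positive measure. Beyond
  -- `T₀ / 2` the powers of `t` have a lower bound independent of `t`.
  have hpos : (volume.restrict (Ioo 0 T₀)) (Ioo (T₀ / 2) T₀) ≠ 0 := by
    rw [Measure.restrict_apply measurableSet_Ioo,
      inter_eq_self_of_subset_left (Ioo_subset_Ioo_left (by linarith)), Real.volume_Ioo]
    simp; linarith
  obtain ⟨t, ⟨ht1, ht2⟩, hta, htS⟩ :=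
    ((frequently_ae_mem_iff.2 hpos).and_eventually (htaylor.and (hS 1))).exists
  have hb := iter_nonneg hμ0 (b := startCoeff) fun n => by unfold startCoeff; positivity
  rw [← Complex.ofReal_sum] at hta
  have h1 : ∑ j ∈ Finset.range J, t ^ j / j.factorial * (ε * iter μ startCoeff j 1) ≤
      ε * B + (ε * B * (2 * m) ^ J * (t ^ J / J.factorial)
        + 12 * (ε * B) ^ 2 * errConst T₀ m J) := by
    have h := norm_le_norm_add_norm_sub (rcoeff (θ t) (line K 1))
      ((∑ j ∈ Finset.range J, t ^ j / j.factorial * (ε * iter μ startCoeff j 1) : ℝ) : ℂ)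
    rw [Complex.norm_real] at h
    exact (le_abs_self _).trans (h.trans (add_le_add htS hta))
  -- The iterates are nonnegative, so lowering `t` to `T₀ / 2` decreases every term.
  have h2 : ε * ∑ j ∈ Finset.range J, (T₀ / 2) ^ j / j.factorial * iter μ startCoeff j 1
      ≤ ∑ j ∈ Finset.range J, t ^ j / j.factorial * (ε * iter μ startCoeff j 1) := by
    rw [Finset.mul_sum]
    refine Finset.sum_le_sum fun j _ => ?_
    rw [mul_left_comm]
    have := hb j 1
    gcongr
  have h3 : t ^ J / J.factorial ≤ T₀ ^ J / J.factorial := by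
    have : 0 ≤ t := by linarith
    gcongr
  have h4 : ε * B * (2 * m) ^ J * (t ^ J / J.factorial)
      ≤ ε * B * (2 * m) ^ J * (T₀ ^ J / J.factorial) :=
    mul_le_mul_of_nonneg_left h3 (by positivity)
  refine le_of_mul_le_mul_left ?_ hε
  linarith

/-- Bounds for the partial sums with errors that vanish as `ε → 0` and `J → ∞` bound each term. -/
theorem pow_div_factorial_le {T₀ m B : ℝ} (hT₀ : 0 < T₀) {b : ℕ → ℝ}
    (hb : ∀ j, 0 ≤ b j) {ε₀ : ℝ} (hε₀ : 0 < ε₀)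
    {C : ℕ → ℝ} (h : ∀ ε, 0 < ε → ε ≤ ε₀ → ∀ J,
      ∑ j ∈ Finset.range J, (T₀ / 2) ^ j / j.factorial * b j
        ≤ B + B * (2 * m) ^ J * (T₀ ^ J / J.factorial) + ε * C J) (j : ℕ) :
    (T₀ / 2) ^ j / j.factorial * b j ≤ B := by
  -- `C J` is not controlled as `J` grows, so `ε → 0` is taken first, with `J` fixed.
  have hJ : ∀ J, ∑ j ∈ Finset.range J, (T₀ / 2) ^ j / j.factorial * b j
      ≤ B + B * (2 * m) ^ J * (T₀ ^ J / J.factorial) := fun J => by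
    have ht : Filter.Tendsto (fun ε : ℝ => B + B * (2 * m) ^ J * (T₀ ^ J / J.factorial) + ε * C J)
        (nhdsWithin 0 (Ioi 0)) (nhds (B + B * (2 * m) ^ J * (T₀ ^ J / J.factorial) + 0 * C J)) :=
      ((by fun_prop : Continuous fun ε : ℝ =>
        B + B * (2 * m) ^ J * (T₀ ^ J / J.factorial) + ε * C J).tendsto 0).mono_left
          nhdsWithin_le_nhds
    rw [zero_mul, add_zero] at ht
    refine ge_of_tendsto ht ?_
    filter_upwards [Ioc_mem_nhdsGT hε₀] with ε hε
    exact h ε hε.1 hε.2 J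
  -- The factorial beats `(2 m T₀) ^ J`, however large `m` is.
  have hlim : Filter.Tendsto (fun J : ℕ => B + B * (2 * m) ^ J * (T₀ ^ J / J.factorial))
      Filter.atTop (nhds (B + B * 0)) := by
    refine Filter.Tendsto.const_add _ ?_
    have := (FloorSemiring.tendsto_pow_div_factorial_atTop (2 * m * T₀)).const_mul B
    refine this.congr fun J => ?_
    rw [mul_pow]; ring
  rw [mul_zero, add_zero] at hlim
  refine ge_of_tendsto hlim ?_
  filter_upwards [Filter.eventually_gt_atTop j] with J hJj
  refine le_trans ?_ (hJ J)
  exact Finset.single_le_sum (f := fun j => (T₀ / 2) ^ j / j.factorial * b j)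
    (fun i _ => mul_nonneg (by positivity) (hb i)) (Finset.mem_range.2 hJj)

theorem zeroVerticalMean_datum (K : ℕ) (ε : ℝ) : ZeroVerticalMean (datum (line K 1) ε) := by
  refine zeroVerticalMean_reTrig _ _ fun i => ?_
  fin_cases i <;> simp [vert, line]

theorem datum_sub (k : Freq) (ε : ℝ) :
    datum k ε - datum k 0 = reTrig ![vert, k] ![0, ((2 * ε : ℝ) : ℂ)] := by
  ext y
  simp only [datum, reTrig, trigPoly, Pi.sub_apply, Fin.sum_univ_two]
  simp

theorem trigSize_datum (k : Freq) (z : ℂ) {ε : ℝ} (hε : 0 ≤ ε) (s : ℕ) :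
    trigSize ![vert, k] ![z, ((2 * ε : ℝ) : ℂ)] s
      = ‖z‖ * weight vert ^ s + 2 * ε * weight k ^ s := by
  rw [trigSize, Fin.sum_univ_two]
  simp [abs_of_nonneg hε]

theorem isSolution_steady (N T : ℝ) {X : SobolevSpace} {k : Freq}
    (h : X.Mem (datum k 0)) : IsSolution N X T (datum k 0) fun _ => datum k 0 where
  measurable := ((continuous_reTrig _ _).comp continuous_snd).aestronglyMeasurable
  bounded := ⟨(X.eNorm (datum k 0)).toNNReal, Filter.Eventually.of_forall fun _ => by
    rw [ENNReal.coe_toNNReal h.ne]⟩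
  integrable l := by
    simp [coeff_advection_of_steadyCoeff N (rcoeff_datum_zero k)]
  equation l := Filter.Eventually.of_forall fun _ => by
    simp [coeff_advection_of_steadyCoeff N (rcoeff_datum_zero k)]

theorem weight_line_le {K : ℕ} (hK : 0 < K) : weight (line K 1) ≤ 4 * K ^ 2 := by
  have hK1 : (1 : ℝ) ≤ K := by exact_mod_cast hK
  rw [weight, Fin.sum_univ_three]
  simp [line]
  nlinarith

theorem rcoeff_sub {f g : T3 → ℝ} (hf : Integrable f haar3) (hg : Integrable g haar3) (k : Freq) :
    rcoeff (f - g) k = rcoeff f k - rcoeff g k := by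
  refine Eq.trans ?_ (coeff_sub hf.ofReal hg.ofReal k)
  simp [rcoeff]

/-- Positive lower and upper bounds of positive continuous functions on `[0, R]²`. -/
theorem exists_bounds_of_continuous {T K : ℝ≥0 × ℝ≥0 → ℝ} (hT : Continuous T) (hK : Continuous K)
    (hT0 : ∀ a, 0 < T a) (hK0 : ∀ a, 0 < K a) (R : ℝ≥0) :
    ∃ T₀ > 0, ∃ K₀ > 0, ∀ x y, x ≤ R → y ≤ R → T₀ ≤ T (x, y) ∧ K (x, y) ≤ K₀ := by
  have hc : IsCompact (Icc (0 : ℝ≥0) R ×ˢ Icc (0 : ℝ≥0) R) := isCompact_Icc.prod isCompact_Icc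
  have hne : (Icc (0 : ℝ≥0) R ×ˢ Icc (0 : ℝ≥0) R).Nonempty := ⟨(0, 0), by simp⟩
  obtain ⟨a, -, ha⟩ := hc.exists_isMinOn hne hT.continuousOn
  obtain ⟨b, -, hb⟩ := hc.exists_isMaxOn hne hK.continuousOn
  exact ⟨T a, hT0 a, K b, hK0 b, fun x y hx hy =>
    ⟨ha (show (x, y) ∈ Icc (0 : ℝ≥0) R ×ˢ Icc (0 : ℝ≥0) R from ⟨⟨zero_le, hx⟩, ⟨zero_le, hy⟩⟩),
     hb (show (x, y) ∈ Icc (0 : ℝ≥0) R ×ˢ Icc (0 : ℝ≥0) R from ⟨⟨zero_le, hx⟩, ⟨zero_le, hy⟩⟩)⟩⟩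

/-- Lipschitz well-posedness bounds the linearised flow with a polynomial loss of the frequency. -/
theorem exists_iter_le_of_lipschitzWellPosed {N : ℝ} (hN : 0 < N) {X Y : SobolevSpace}
    (hX : X.Embeds W14) (hYX : Y.Embeds X) (h : LipschitzWellPosed N X Y) :
    ∃ T₀ > 0, ∃ (C : ℝ) (s : ℕ), ∀ K : ℕ, 0 < K → ∀ j : ℕ,
      (T₀ / 2) ^ j / j.factorial * iter (fun n => symbolM N 2 (line K n)) startCoeff j 1
        ≤ C * weight (line K 1) ^ s := by
  obtain ⟨T, L, hTc, hLc, hT0, hL0, hwp⟩ := h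
  obtain ⟨CX, hCX⟩ := hX
  obtain ⟨CY, hCY⟩ := hYX
  obtain ⟨C, s, hC⟩ := trigBounded_eNorm Y
  -- For `ε ≤ W⁻¹` the perturbation contributes at most 2 to the size of the datum. So `R` bounds
  -- all `Y` norms independently of `K`, and the existence time and the Lipschitz constant are
  -- uniform in `K`.
  set R : ℝ≥0 := C * Real.toNNReal (weight vert ^ s + 2)
  obtain ⟨T₀, hT₀, L₀, hL₀, hTL⟩ := exists_bounds_of_continuous hTc hLc hT0 hL0 R
  refine ⟨T₀, hT₀, CX * (L₀ * (C * 2)), s, fun K hK => ?_⟩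
  set k := line K 1
  set W := weight k ^ s
  have hW : 0 < W := pow_pos (zero_lt_one.trans_le (one_le_weight k)) s
  have hdat : ∀ ε, 0 ≤ ε → ε ≤ W⁻¹ → Y.eNorm (datum k ε) ≤ R := fun ε h0 h1 => by
    refine (hC _ _ _).trans ?_
    rw [trigSize_datum k _ h0, ENNReal.coe_mul]
    refine mul_le_mul_right (ENNReal.ofReal_le_ofReal ?_) _
    change _ + 2 * ε * W ≤ _
    have : ε * W ≤ 1 := by
      calc ε * W ≤ W⁻¹ * W := mul_le_mul_of_nonneg_right h1 hW.le
        _ = 1 := inv_mul_cancel₀ hW.ne'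
    simp only [Complex.norm_I]
    linarith
  have hmem : ∀ ε, 0 ≤ ε → ε ≤ W⁻¹ → Y.Mem (datum k ε) := fun ε h0 h1 =>
    (hdat ε h0 h1).trans_lt ENNReal.coe_lt_top
  have hle : ∀ ε, 0 ≤ ε → ε ≤ W⁻¹ → (Y.eNorm (datum k ε)).toNNReal ≤ R := fun ε h0 h1 =>
    by simpa using ENNReal.toNNReal_mono ENNReal.coe_ne_top (hdat ε h0 h1)
  have hWi : 0 < W⁻¹ := inv_pos.2 hW
  refine pow_div_factorial_le (m := K ^ 2 / N ^ 2)
    (C := fun J => 12 * (CX * (L₀ * (C * 2)) * W) ^ 2 * errConst T₀ (K ^ 2 / N ^ 2) J) hT₀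
    (fun j => iter_nonneg (fun n => (symbolM_two_line_bounds hN hK n).1)
      (fun n => by unfold startCoeff; positivity) j 1) hWi
    fun ε hε hε1 J => ?_
  obtain ⟨θ₁, θ₂, ⟨hθ₁, -⟩, ⟨hθ₂, huniq⟩, hlip⟩ := hwp (datum k ε) (datum k 0)
    (hmem ε hε.le hε1) (hmem 0 le_rfl hWi.le) (zeroVerticalMean_datum K ε)
    (zeroVerticalMean_datum K 0)
  obtain ⟨hTle, hLle⟩ := hTL _ _ (hle ε hε.le hε1) (hle 0 le_rfl hWi.le)
  have hsub := Ioo_subset_Ioo_right (b := (0 : ℝ)) hTle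
  have hXmem : X.Mem (datum k 0) := (hCY _).trans_lt
    (ENNReal.mul_lt_top ENNReal.coe_lt_top (hmem 0 le_rfl hWi.le))
  -- Uniqueness identifies `θ₂` with the stationary solution.
  have hst := huniq _ (isSolution_steady N _ hXmem)
  obtain ⟨M, hM⟩ := hθ₁.bounded
  refine sum_iter_le_of_isSolution hN hK hT₀ hTle hε (by positivity) hθ₁
    (w := fun t => θ₁ t - θ₂ t) ?_ J
  refine ae_restrict_of_ae_restrict_of_subset hsub ?_
  filter_upwards [hst, hlip, hM] with t hst hlip hM
  refine ⟨?_, fun l => ?_⟩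
  · calc W14.eNorm (θ₁ t - θ₂ t) ≤ CX * X.eNorm (θ₁ t - θ₂ t) := hCX _
      _ ≤ CX * (ENNReal.ofReal L₀ * (C * ENNReal.ofReal (2 * ε * W))) := by
        gcongr
        refine hlip.trans ?_
        gcongr
        rw [datum_sub]
        refine (hC _ _ _).trans ?_
        rw [trigSize_datum k _ hε.le, norm_zero, zero_mul, zero_add]
      _ = ENNReal.ofReal (ε * (CX * (L₀ * (C * 2)) * W)) := by
        rw [← ENNReal.ofReal_coe_nnreal (p := C), ← ENNReal.ofReal_coe_nnreal (p := CX),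
          ← ENNReal.ofReal_mul (by positivity), ← ENNReal.ofReal_mul (by positivity),
          ← ENNReal.ofReal_mul (by positivity)]
        congr 1; ring
  · have hint₁ : Integrable (θ₁ t) haar3 := integrable_of_W14 ((hCX _).trans_lt
      (ENNReal.mul_lt_top ENNReal.coe_lt_top (hM.trans_lt ENNReal.coe_lt_top)))
    have hint₀ : Integrable (datum k 0) haar3 := (continuous_reTrig _ _).integrable_of_hasCompactSupport
      (HasCompactSupport.of_compactSpace _)
    have hco : rcoeff (θ₂ t) l = steadyCoeff l := by
      rw [← rcoeff_datum_zero k]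
      exact coeff_congr (hst.symm.mono fun y hy => by simp only [hy]) l
    rw [rcoeff_sub hint₁ (hint₀.congr hst), hco]
    ring

end MG
end

/-! ### Contradiction by comparing powers of `K` -/

theorem theorem3p3 (N : ℝ) (hN : 0 < N) (X Y : MG.SobolevSpace)
    (hX : X.Embeds MG.W14) (hYX : Y.Embeds X) :
    ¬ MG.LipschitzWellPosed N X Y := by
  intro h
  obtain ⟨T₀, hT₀, C, s, hC⟩ := MG.exists_iter_le_of_lipschitzWellPosed hN hX hYX h
  set c : ℝ := N ^ 2 / (3 * N ^ 4 + 1)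
  have hc : 0 < c := by positivity
  -- The Taylor term of degree `2 * (s + 1)` is at least `d * (K ^ 2) ^ (2 * (s + 1))`. The degree
  -- is even because the walk must return to `n = 1`, and large enough to beat the loss `weight ^
  -- s`, which is of order `(K ^ 2) ^ s`.
  set d : ℝ := (T₀ / 2) ^ (2 * (s + 1)) / (2 * (s + 1)).factorial * c ^ (2 * (s + 1))
  have hd : 0 < d := by positivity
  obtain ⟨K, hK⟩ := exists_nat_gt (max 1 (|C| * 4 ^ s / d))
  have hK1 : (1 : ℝ) < K := (le_max_left _ _).trans_lt hK
  have hK0 : 0 < K := by exact_mod_cast zero_lt_one.trans hK1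
  have hK2 : |C| * 4 ^ s < K * d := by
    rw [← div_lt_iff₀ hd]; exact (le_max_right _ _).trans_lt hK
  have hiter := MG.pow_le_iter (μ := fun n => MG.symbolM N 2 (MG.line K n)) (b := MG.startCoeff)
    (c := c * K ^ 2) (fun n => (MG.symbolM_two_line_bounds hN hK0 n).1)
    (fun n => by unfold MG.startCoeff; positivity) (by simp [MG.startCoeff]) (by positivity)
    (MG.le_symbolM_two_line hN hK0 (by norm_num)) (MG.le_symbolM_two_line hN hK0 (by norm_num))
    (s + 1)
  have hw0 : 0 ≤ MG.weight (MG.line K 1) := zero_le_one.trans (MG.one_le_weight _)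
  have key : d * (K ^ 2) ^ (2 * (s + 1)) ≤ |C| * 4 ^ s * (K ^ 2) ^ s := by
    calc d * ((K : ℝ) ^ 2) ^ (2 * (s + 1))
        = (T₀ / 2) ^ (2 * (s + 1)) / (2 * (s + 1)).factorial * (c * K ^ 2) ^ (2 * (s + 1)) := by
          rw [mul_pow]; ring
      _ ≤ _ := mul_le_mul_of_nonneg_left hiter (by positivity)
      _ ≤ C * MG.weight (MG.line K 1) ^ s := hC K hK0 _
      _ ≤ |C| * (4 * K ^ 2) ^ s := mul_le_mul (le_abs_self C)
          (pow_le_pow_left₀ hw0 (MG.weight_line_le hK0) s) (pow_nonneg hw0 s) (abs_nonneg C)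
      _ = |C| * 4 ^ s * (K ^ 2) ^ s := by rw [mul_pow]; ring
  have hKs : 0 < ((K : ℝ) ^ 2) ^ s := by positivity
  -- One spare factor `K` suffices, since `K * d > |C| * 4 ^ s`; in exponents, `2 s + 1 ≤ 4 (s +
  -- 1)`.
  have hbig : (K : ℝ) * ((K : ℝ) ^ 2) ^ s ≤ ((K : ℝ) ^ 2) ^ (2 * (s + 1)) := by
    rw [← pow_mul, ← pow_mul, ← pow_succ']
    exact pow_le_pow_right₀ hK1.le (by omega)
  nlinarith [mul_le_mul_of_nonneg_left hbig hd.le, mul_lt_mul_of_pos_right hK2 hKs]
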